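/- Let $(M,g,J)$ be an almost Hermitian manifold: $M$ is a smooth (finite-dimensional, Hausdorff) manifold, $g$ a smooth Riemannian metric and $J$ a smooth almost complex structure with $g(JX,JY)=g(X,Y)$. Put $\omega(X,Y):=g(JX,Y)$ and $$N(X,Y):=J[JX,Y]+J[X,JY]+[X,Y]-[JX,JY].$$ The exterior derivative is normalized by $$d\omega(X,Y,Z)=X\omega(Y,Z)-Y\omega(X,Z)+Z\omega(X,Y)-\omega([X,Y],Z)+\omega([X,Z],Y)-\omega([Y,Z],X),$$ and $(d\omega)^+$ denotes the $(2,1)+(1,2)$-part of $d\omega$ with respect to $J$. Let $\Omega^{(1,1)}(M;TM)$ be the space of smooth real $TM$-valued $2$-forms of type $(1,1)$ with respect to $J$, and for $\alpha\in\Omega^{(1,1)}(M;TM)$ put $$\alpha^+(X,Y,Z):=g(\alpha(X,Y),Z)+g(\alpha(Y,Z),X)+g(\alpha(Z,X),Y).$$ A smooth linear connection $\nabla$ on $M$ is called $g$-compatible if $\nabla g=0$, and Hermitian if $\nabla g=0$ and $\nabla J=0$; its torsion is $T(X,Y)=\nabla_XY-\nabla_YX-[X,Y]$. (i) A $g$-compatible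 connection on $M$ is Hermitian if and only if there is an $\alpha\in\Omega^{(1,1)}(M;TM)$ such that its torsion $T$ satisfies, for all smooth vector fields $X,Y,Z$, $$\begin{aligned} g(T(X,Y),Z)={}&-\tfrac14 g(N(X,Y),Z)-\tfrac12(d\omega)^+(JX,JY,JZ)+\tfrac12(d\omega)^+(X,Y,JZ)\\ &+\tfrac12\alpha^+(X,Y,Z)-\tfrac12\alpha^+(JX,JY,Z)+g(\alpha(X,Y),Z).\end{aligned}\qquad(*)$$ (ii) Relation $(*)$ between the torsion of $\nabla$ and $\alpha$ is a one-to-one correspondence between the Hermitian connections on $(M,g,J)$ and $\Omega^{(1,1)}(M;TM)$: every Hermitian connection satisfies $(*)$ for exactly one $\alpha$, and every $\alpha\in\Omega^{(1,1)}(M;TM)$ arises in this way from exactly one Hermitian connection. -/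

import Mathlib

open Bundle
open scoped Manifold ContDiff

noncomputable section

/-! ## Types of real multilinear maps on a real vector space with a complex structure

An element `a + i b` of the complexification of a real vector space `V` is written as the pair
`(a, b) : V × V`. -/

section Types

variable {V W : Type*} [AddCommGroup V] [Module ℝ V] [AddCommGroup W] [Module ℝ W]

/-- The `(1,0)`-component `X⁺ = (X - i J X) / 2`. -/
def holPart (J : V → V) (X : V) : V × V := ((1 / 2 : ℝ) • X, -((1 / 2 : ℝ) • J X))

/-- The `(0,1)`-component `X⁻ = (X + i J X) / 2`. -/
def antiholPart (J : V → V) (X : V) : V × V := ((1 / 2 : ℝ) • X, (1 / 2 : ℝ) • J X)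

/-- The complex bilinear extension of a real bilinear map, with values in `W ⊕ i W`. -/
def complexBilin (B : V → V → W) (x y : V × V) : W × W :=
  (B x.1 y.1 - B x.2 y.2, B x.1 y.2 + B x.2 y.1)

/-- The complex trilinear extension of a real trilinear form. -/
def complexTrilin (η : V → V → V → ℝ) (x y z : V × V) : ℂ :=
  ⟨η x.1 y.1 z.1 - η x.1 y.2 z.2 - η x.2 y.1 z.2 - η x.2 y.2 z.1,
   η x.2 y.1 z.1 + η x.1 y.2 z.1 + η x.1 y.1 z.2 - η x.2 y.2 z.2⟩

/-- The `(2,1) + (1,2)`-part `η⁺` of a real trilinear form `η`: the sum of the six components of `η`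
of mixed type. The sum is invariant under complex conjugation, hence it is equal to its real
part. -/
def mixedPart (J : V → V) (η : V → V → V → ℝ) (X Y Z : V) : ℝ :=
  (complexTrilin η (holPart J X) (holPart J Y) (antiholPart J Z) +
    complexTrilin η (holPart J X) (antiholPart J Y) (holPart J Z) +
    complexTrilin η (antiholPart J X) (holPart J Y) (holPart J Z) +
    complexTrilin η (antiholPart J X) (antiholPart J Y) (holPart J Z) +
    complexTrilin η (antiholPart J X) (holPart J Y) (antiholPart J Z) +
    complexTrilin η (holPart J X) (antiholPart J Y) (antiholPart J Z)).re

/-- A real bilinear map is of type `(1,1)` if its `(2,0)`- and `(0,2)`-parts vanish. -/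
def IsType11 (J : V → V) (B : V → V → W) : Prop :=
  ∀ X Y : V, complexBilin B (holPart J X) (holPart J Y) = 0 ∧
    complexBilin B (antiholPart J X) (antiholPart J Y) = 0

end Types

/-! ## Vector fields -/

section Manifold

variable (E : Type*) [NormedAddCommGroup E] [NormedSpace ℝ E]
  (M : Type*) [TopologicalSpace M] [ChartedSpace E M] [IsManifold 𝓘(ℝ, E) ∞ M]

/-- Smooth vector fields on `M`. -/
abbrev SmoothVectorField : Type _ :=
  Cₛ^∞⟮𝓘(ℝ, E); E, (TangentSpace 𝓘(ℝ, E) : M → Type _)⟯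

variable {E M}

/-- The product `f X` of a smooth function and a smooth vector field. -/
def SmoothVectorField.fsmul (f : C^∞⟮𝓘(ℝ, E), M; 𝓘(ℝ, ℝ), ℝ⟯) (X : SmoothVectorField E M) :
    SmoothVectorField E M where
  toFun := fun p => f p • X p
  contMDiff_toFun := f.contMDiff.smul_section X.contMDiff

/-- The derivative `X f` of a function along a vector field. -/
def SmoothVectorField.deriv (X : SmoothVectorField E M) (f : M → ℝ) (p : M) : ℝ :=
  mvfderiv 𝓘(ℝ, E) f p (X p)

/-- The Lie bracket `[X, Y]`. -/
def SmoothVectorField.bracket (X Y : SmoothVectorField E M) (p : M) : TangentSpace 𝓘(ℝ, E) p :=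
  VectorField.mlieBracket 𝓘(ℝ, E) X Y p

/-! ## Almost Hermitian structures -/

variable (E M) in
/-- An almost Hermitian structure on `M`: a smooth Riemannian metric `g` and a smooth almost
complex structure `J` with `g (J u) (J v) = g u v`. -/
structure AlmostHermitianStructure where
  /-- The metric `g`. -/
  metric : ContMDiffRiemannianMetric 𝓘(ℝ, E) ∞ E (TangentSpace 𝓘(ℝ, E) : M → Type _)
  /-- The almost complex structure `J`. -/
  J (p : M) : TangentSpace 𝓘(ℝ, E) p →L[ℝ] TangentSpace 𝓘(ℝ, E) p
  contMDiff_J : ContMDiff 𝓘(ℝ, E) (𝓘(ℝ, E).prod 𝓘(ℝ, E →L[ℝ] E)) ∞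
    (fun p => TotalSpace.mk' (E →L[ℝ] E)
      (E := fun p : M => TangentSpace 𝓘(ℝ, E) p →L[ℝ] TangentSpace 𝓘(ℝ, E) p) p (J p))
  J_J (p : M) (v : TangentSpace 𝓘(ℝ, E) p) : J p (J p v) = -v
  metric_J (p : M) (v w : TangentSpace 𝓘(ℝ, E) p) :
    metric.inner p (J p v) (J p w) = metric.inner p v w

namespace AlmostHermitianStructure

variable (S : AlmostHermitianStructure E M)

/-- The function `g (X, Y)`. -/
def gField (X Y : SmoothVectorField E M) (p : M) : ℝ := S.metric.inner p (X p) (Y p)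

/-- The vector field `J X`. -/
def JField (X : SmoothVectorField E M) : SmoothVectorField E M where
  toFun := fun p => S.J p (X p)
  contMDiff_toFun := S.contMDiff_J.clm_bundle_apply X.contMDiff

/-- The fundamental 2-form `ω u v = g (J u) v`. -/
def omega (p : M) (u v : TangentSpace 𝓘(ℝ, E) p) : ℝ := S.metric.inner p (S.J p u) v

/-- The function `ω (X, Y)`. -/
def omegaField (X Y : SmoothVectorField E M) (p : M) : ℝ := S.omega p (X p) (Y p)

/-- The exterior derivative `dω` of the fundamental 2-form, as a function of vector fields. -/
def dOmega (X Y Z : SmoothVectorField E M) (p : M) : ℝ :=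
  X.deriv (S.omegaField Y Z) p - Y.deriv (S.omegaField X Z) p + Z.deriv (S.omegaField X Y) p
    - S.omega p (X.bracket Y p) (Z p) + S.omega p (X.bracket Z p) (Y p)
    - S.omega p (Y.bracket Z p) (X p)

/-- The `(2,1) + (1,2)`-part `(dω)⁺` of `dω`. -/
def dOmegaPlus (X Y Z : SmoothVectorField E M) (p : M) : ℝ :=
  mixedPart S.JField (fun X Y Z => S.dOmega X Y Z p) X Y Z

/-- The Nijenhuis tensor `N (X, Y) = J [J X, Y] + J [X, J Y] + [X, Y] - [J X, J Y]`. -/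
def nijenhuis (X Y : SmoothVectorField E M) (p : M) : TangentSpace 𝓘(ℝ, E) p :=
  S.J p ((S.JField X).bracket Y p) + S.J p (X.bracket (S.JField Y) p)
    + X.bracket Y p - (S.JField X).bracket (S.JField Y) p

/-- The space `Ω^{(1,1)}(M; TM)` of smooth real `TM`-valued 2-forms of type `(1,1)`. -/
@[ext]
structure TangentForm11 where
  /-- The bilinear map `α p : T_p M × T_p M → T_p M`. -/
  toFun (p : M) : TangentSpace 𝓘(ℝ, E) p →L[ℝ] TangentSpace 𝓘(ℝ, E) p →L[ℝ] TangentSpace 𝓘(ℝ, E) p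
  contMDiff_toFun : ContMDiff 𝓘(ℝ, E) (𝓘(ℝ, E).prod 𝓘(ℝ, E →L[ℝ] E →L[ℝ] E)) ∞
    (fun p => TotalSpace.mk' (E →L[ℝ] E →L[ℝ] E)
      (E := fun p : M => TangentSpace 𝓘(ℝ, E) p →L[ℝ] TangentSpace 𝓘(ℝ, E) p →L[ℝ]
        TangentSpace 𝓘(ℝ, E) p) p (toFun p))
  alternating (p : M) (v : TangentSpace 𝓘(ℝ, E) p) : toFun p v v = 0
  type11 (p : M) : IsType11 (S.J p) (fun u v => toFun p u v)

variable {S} in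
/-- `α⁺ (X, Y, Z) = g (α (X, Y), Z) + g (α (Y, Z), X) + g (α (Z, X), Y)`. -/
def TangentForm11.plus (α : S.TangentForm11) (X Y Z : SmoothVectorField E M) (p : M) : ℝ :=
  S.metric.inner p (α.toFun p (X p) (Y p)) (Z p)
    + S.metric.inner p (α.toFun p (Y p) (Z p)) (X p)
    + S.metric.inner p (α.toFun p (Z p) (X p)) (Y p)

end AlmostHermitianStructure

/-! ## Connections -/

variable (E M) in
/-- A (smooth, linear) connection on `M`, i.e. a map `(X, Y) ↦ ∇_X Y` on smooth vector fields which
is `C^∞(M)`-linear in `X`, additive in `Y` and satisfies the Leibniz rule in `Y`. (Mathlib's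
`CovariantDerivative` also prescribes unconstrained values on non-differentiable vector fields, so
that its elements do not correspond one-to-one to connections.) -/
@[ext]
structure SmoothConnection where
  /-- The vector field `∇_X Y`. -/
  toFun : SmoothVectorField E M → SmoothVectorField E M → SmoothVectorField E M
  add_left (X X' Y : SmoothVectorField E M) : toFun (X + X') Y = toFun X Y + toFun X' Y
  fsmul_left (f : C^∞⟮𝓘(ℝ, E), M; 𝓘(ℝ, ℝ), ℝ⟯) (X Y : SmoothVectorField E M) :
    toFun (X.fsmul f) Y = (toFun X Y).fsmul f
  add_right (X Y Y' : SmoothVectorField E M) : toFun X (Y + Y') = toFun X Y + toFun X Y'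
  leibniz (f : C^∞⟮𝓘(ℝ, E), M; 𝓘(ℝ, ℝ), ℝ⟯) (X Y : SmoothVectorField E M) (p : M) :
    toFun X (Y.fsmul f) p = X.deriv f p • Y p + f p • toFun X Y p

namespace SmoothConnection

variable (D : SmoothConnection E M) (S : AlmostHermitianStructure E M)

/-- The torsion `T (X, Y) = ∇_X Y - ∇_Y X - [X, Y]`. -/
def torsion (X Y : SmoothVectorField E M) (p : M) : TangentSpace 𝓘(ℝ, E) p :=
  D.toFun X Y p - D.toFun Y X p - X.bracket Y p

/-- `∇ g = 0`. -/
def IsMetric : Prop :=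
  ∀ (X Y Z : SmoothVectorField E M) (p : M),
    X.deriv (S.gField Y Z) p - S.gField (D.toFun X Y) Z p - S.gField Y (D.toFun X Z) p = 0

/-- `∇ J = 0`. -/
def PreservesJ : Prop :=
  ∀ X Y : SmoothVectorField E M, D.toFun X (S.JField Y) - S.JField (D.toFun X Y) = 0

/-- A connection is Hermitian if `∇ g = 0` and `∇ J = 0`. -/
def IsHermitian : Prop := D.IsMetric S ∧ D.PreservesJ S

variable {S} in
/-- The torsion `T` of the connection satisfies
`g (T (X, Y), Z) = - g (N (X, Y), Z) / 4 - (dω)⁺ (J X, J Y, J Z) / 2 + (dω)⁺ (X, Y, J Z) / 2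
  + α⁺ (X, Y, Z) / 2 - α⁺ (J X, J Y, Z) / 2 + g (α (X, Y), Z)`. -/
def HasTorsionOf (α : S.TangentForm11) : Prop :=
  ∀ (X Y Z : SmoothVectorField E M) (p : M),
    S.metric.inner p (D.torsion X Y p) (Z p) =
      -(1 / 4) * S.metric.inner p (S.nijenhuis X Y p) (Z p)
        - (1 / 2) * S.dOmegaPlus (S.JField X) (S.JField Y) (S.JField Z) p
        + (1 / 2) * S.dOmegaPlus X Y (S.JField Z) p
        + (1 / 2) * α.plus X Y Z p
        - (1 / 2) * α.plus (S.JField X) (S.JField Y) Z p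
        + S.metric.inner p (α.toFun p (X p) (Y p)) (Z p)

end SmoothConnection

end Manifold

end

/-! A metric connection is determined by its torsion: with `t X Y Z = g(T(X,Y),Z)`, twice `g(∇_X Y,
Z)` is the Koszul expression of `g` plus the contorsion `t X Y Z - t X Z Y - t Y Z X`
(`IsMetric.koszul_formula`). Conversely, every smooth tensor `t` that is skew in its first two slots
is the torsion of a metric connection, because its contorsion is skew in the last two slots
(`exists_connection`).

Let `F(X,Y,Z) = g((D₀_X J)Y, Z)` for the Levi-Civita connection `D₀`. Subtracting the Koszul
formulas of `D` and `D₀` turns `DJ = 0` into a linear equation between `t` and `F`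
(`IsMetric.two_mul_covDerivJ`). Since `D₀` is torsion-free, `dω` is the cyclic sum of `F`, and `N`
is also linear in `F`. At each point the theorem thus becomes linear algebra.

Three identities settle it. The prescribed torsion solves the equation
(`preservesJ_of_prescribedTorsion`). Every solution is prescribed by its own (1,1)-part
(`eq_prescribedTorsion`). The (1,1)-part of the prescribed torsion is `α`
(`prescribedTorsion_add_J`), so the torsion determines `α`.

The analytic work is to pass between `C^∞`-linear operators on global vector fields and smooth
tensor fields, by means of bump functions and local frames. -/

noncomputable section

/-! ### Calculus of smooth vector fields -/

section VectorFields

variable {E : Type*} [NormedAddCommGroup E] [NormedSpace ℝ E]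
  {M : Type*} [TopologicalSpace M] [ChartedSpace E M] [IsManifold 𝓘(ℝ, E) ∞ M]

namespace SmoothVectorField

@[simp] theorem fsmul_apply (f : C^∞⟮𝓘(ℝ, E), M; 𝓘(ℝ, ℝ), ℝ⟯) (X : SmoothVectorField E M) (p : M) :
    X.fsmul f p = f p • X p := rfl

@[simp] theorem add_apply (X Y : SmoothVectorField E M) (p : M) : (X + Y) p = X p + Y p := rfl

@[simp] theorem neg_apply (X : SmoothVectorField E M) (p : M) : (-X) p = -X p := rfl

@[simp] theorem smul_apply (c : ℝ) (X : SmoothVectorField E M) (p : M) : (c • X) p = c • X p := rfl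

theorem sum_apply {ι : Type*} (s : Finset ι) (X : ι → SmoothVectorField E M) (q : M) :
    (∑ i ∈ s, X i) q = ∑ i ∈ s, X i q := by
  rw [← ContMDiffSection.coeAddHom_apply, map_sum, Finset.sum_apply]; rfl

theorem deriv_add (X : SmoothVectorField E M) {f g : M → ℝ} {p : M}
    (hf : MDifferentiableAt 𝓘(ℝ, E) 𝓘(ℝ, ℝ) f p) (hg : MDifferentiableAt 𝓘(ℝ, E) 𝓘(ℝ, ℝ) g p) :
    X.deriv (fun q => f q + g q) p = X.deriv f p + X.deriv g p := by
  simp [SmoothVectorField.deriv, mvfderiv_fun_add hf hg]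

theorem deriv_mul (X : SmoothVectorField E M) {f g : M → ℝ} {p : M}
    (hf : MDifferentiableAt 𝓘(ℝ, E) 𝓘(ℝ, ℝ) f p) (hg : MDifferentiableAt 𝓘(ℝ, E) 𝓘(ℝ, ℝ) g p) :
    X.deriv (fun q => f q * g q) p = f p * X.deriv g p + X.deriv f p * g p := by
  simp [SmoothVectorField.deriv, mvfderiv_fun_mul hf hg]
  ring

theorem deriv_add_left (X Y : SmoothVectorField E M) (f : M → ℝ) (p : M) :
    (X + Y).deriv f p = X.deriv f p + Y.deriv f p := by
  simp [SmoothVectorField.deriv]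

theorem deriv_fsmul_left (f : C^∞⟮𝓘(ℝ, E), M; 𝓘(ℝ, ℝ), ℝ⟯) (X : SmoothVectorField E M) (h : M → ℝ)
    (p : M) : (X.fsmul f).deriv h p = f p * X.deriv h p := by
  simp [SmoothVectorField.deriv]

theorem deriv_const (X : SmoothVectorField E M) (c : ℝ) (p : M) :
    X.deriv (fun _ => c) p = 0 := by
  simp [SmoothVectorField.deriv, mvfderiv]

theorem contMDiff_deriv (X : SmoothVectorField E M) {f : M → ℝ}
    (hf : ContMDiff 𝓘(ℝ, E) 𝓘(ℝ, ℝ) ∞ f) : ContMDiff 𝓘(ℝ, E) 𝓘(ℝ, ℝ) ∞ (X.deriv f) := by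
  have h := (hf.contMDiff_tangentMap (m := ∞) (by simp)).comp X.contMDiff
  exact (contMDiff_snd_tangentBundle_modelSpace ℝ 𝓘(ℝ, ℝ)).comp h

theorem bracket_swap (X Y : SmoothVectorField E M) (p : M) : X.bracket Y p = -Y.bracket X p :=
  VectorField.mlieBracket_swap_apply

variable [FiniteDimensional ℝ E]

theorem bracket_add_right (X Y Z : SmoothVectorField E M) (p : M) :
    X.bracket (Y + Z) p = X.bracket Y p + X.bracket Z p :=
  VectorField.mlieBracket_add_right Y.mdifferentiableAt Z.mdifferentiableAt

theorem bracket_add_left (X Y Z : SmoothVectorField E M) (p : M) :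
    (X + Y).bracket Z p = X.bracket Z p + Y.bracket Z p :=
  VectorField.mlieBracket_add_left X.mdifferentiableAt Y.mdifferentiableAt

theorem bracket_fsmul_right (f : C^∞⟮𝓘(ℝ, E), M; 𝓘(ℝ, ℝ), ℝ⟯) (X Y : SmoothVectorField E M) (p : M) :
    X.bracket (Y.fsmul f) p = X.deriv f p • Y p + f p • X.bracket Y p :=
  VectorField.mlieBracket_smul_right f.mdifferentiable.mdifferentiableAt Y.mdifferentiableAt

theorem bracket_fsmul_left (f : C^∞⟮𝓘(ℝ, E), M; 𝓘(ℝ, ℝ), ℝ⟯) (X Y : SmoothVectorField E M) (p : M) :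
    (X.fsmul f).bracket Y p = -(Y.deriv f p • X p) + f p • X.bracket Y p := by
  rw [bracket_swap, bracket_fsmul_right, bracket_swap Y X]
  simp [add_comm]

theorem contMDiff_bracket (X Y : SmoothVectorField E M) :
    ContMDiff 𝓘(ℝ, E) (𝓘(ℝ, E).prod 𝓘(ℝ, E)) ∞
      (fun p => TotalSpace.mk' E (E := (TangentSpace 𝓘(ℝ, E) : M → Type _)) p (X.bracket Y p)) := by
  -- The bracket costs one derivative, which is harmless here because `∞ + 1 = ∞`.
  have : IsManifold 𝓘(ℝ, E) ((⊤ : ℕ∞) + 1) M := by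
    simpa using! (inferInstance : IsManifold 𝓘(ℝ, E) ∞ M)
  have : IsManifold 𝓘(ℝ, E) (minSmoothness ℝ 2) M := by
    rw [minSmoothness_of_isRCLikeNormedField]; infer_instance
  intro p
  exact ContMDiffAt.mlieBracket_vectorField (m := ⊤) (n := ⊤) X.contMDiff.contMDiffAt
    Y.contMDiff.contMDiffAt (by simp)

end SmoothVectorField

end VectorFields

/-! ### Tensoriality: `C^∞`-linear maps depend only on values at a point -/

section Tensorial

variable {E : Type*} [NormedAddCommGroup E] [NormedSpace ℝ E]
  {M : Type*} [TopologicalSpace M] [ChartedSpace E M] [IsManifold 𝓘(ℝ, E) ∞ M]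
  {A : Type*} [AddCommGroup A] [Module ℝ A]

/-- A map on vector fields which is `C^∞`-linear at the point `p`. -/
structure IsTensorialAt (φ : SmoothVectorField E M → A) (p : M) : Prop where
  map_add (X Y : SmoothVectorField E M) : φ (X + Y) = φ X + φ Y
  map_fsmul (f : C^∞⟮𝓘(ℝ, E), M; 𝓘(ℝ, ℝ), ℝ⟯) (X : SmoothVectorField E M) :
    φ (X.fsmul f) = f p • φ X

namespace IsTensorialAt

variable {φ : SmoothVectorField E M → A} {p : M}

theorem map_zero (h : IsTensorialAt φ p) : φ 0 = 0 := by
  simpa using h.map_add 0 0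

theorem map_smul (h : IsTensorialAt φ p) (c : ℝ) (X : SmoothVectorField E M) :
    φ (c • X) = c • φ X :=
  h.map_fsmul ⟨fun _ => c, contMDiff_const⟩ X

theorem map_neg (h : IsTensorialAt φ p) (X : SmoothVectorField E M) : φ (-X) = -φ X := by
  rw [← neg_one_smul ℝ X, h.map_smul]; simp

theorem map_sum (h : IsTensorialAt φ p) {ι : Type*} (s : Finset ι) (X : ι → SmoothVectorField E M) :
    φ (∑ i ∈ s, X i) = ∑ i ∈ s, φ (X i) :=
  _root_.map_sum (⟨⟨φ, h.map_zero⟩, h.map_add⟩ : SmoothVectorField E M →+ A) X s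

end IsTensorialAt

end Tensorial

section Tensoriality

open Filter Topology Module

variable {E : Type*} [NormedAddCommGroup E] [NormedSpace ℝ E] [FiniteDimensional ℝ E]
  {M : Type*} [TopologicalSpace M] [T2Space M] [ChartedSpace E M] [IsManifold 𝓘(ℝ, E) ∞ M]

namespace SmoothVectorField

theorem exists_localFrame (p : M) :
    ∃ X : Fin (finrank ℝ E) → SmoothVectorField E M,
      (∀ᶠ q in 𝓝 p, ∀ i, X i q = (trivializationAt E (TangentSpace 𝓘(ℝ, E)) p).localFrame
        (finBasis ℝ E) i q) ∧
      ∃ f : C^∞⟮𝓘(ℝ, E), M; 𝓘(ℝ, ℝ), ℝ⟯, f p = 1 ∧ ∀ Z : SmoothVectorField E M,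
        ∃ c : Fin (finrank ℝ E) → C^∞⟮𝓘(ℝ, E), M; 𝓘(ℝ, ℝ), ℝ⟯,
          Z.fsmul f = ∑ i, (X i).fsmul (c i) := by
  set e := trivializationAt E (TangentSpace 𝓘(ℝ, E) : M → Type _) p
  set b := finBasis ℝ E
  obtain ⟨f⟩ : Nonempty (SmoothBumpFunction 𝓘(ℝ, E) p) := inferInstance
  have hsub : tsupport f ⊆ e.baseSet := f.tsupport_subset_chartAt_source
  let X (i) : SmoothVectorField E M :=
    ⟨fun q => f q • e.localFrame b i q,
      f.contMDiff.contMDiffOn.smul_section_of_tsupport e.open_baseSet hsub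
        (e.contMDiffOn_localFrame_baseSet ∞ b i)⟩
  -- The square of the bump function occurs because the extended frame fields and the extended
  -- coefficients each need one factor.
  refine ⟨X, ?_, ⟨fun q => f q * f q, f.contMDiff.mul f.contMDiff⟩, ?_, fun Z => ?_⟩
  · filter_upwards [f.eventuallyEq_one] with q hq i
    simp [X, hq, e, b]
  · simp
  · let c (i) : C^∞⟮𝓘(ℝ, E), M; 𝓘(ℝ, ℝ), ℝ⟯ :=
      ⟨fun q => f q • e.localFrameCoeff 𝓘(ℝ, E) b i q (Z q),
        f.contMDiff_smul (contMDiffOn_baseSet_localFrameCoeff b Z.contMDiff.contMDiffOn i)⟩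
    refine ⟨c, ContMDiffSection.ext fun q => ?_⟩
    have hsum : (∑ i, (X i).fsmul (c i)) q = ∑ i, (X i).fsmul (c i) q := by
      rw [← ContMDiffSection.coeAddHom_apply, map_sum, Finset.sum_apply]; rfl
    rw [hsum]
    by_cases hq : q ∈ e.baseSet
    · change (f q * f q) • Z q =
        ∑ i, (f q • e.localFrameCoeff 𝓘(ℝ, E) b i q (Z q)) • f q • e.localFrame b i q
      conv_lhs => rw [e.eq_sum_localFrameCoeff_smul (I := 𝓘(ℝ, E)) (b := b) (s := Z) hq]
      rw [Finset.smul_sum]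
      refine Finset.sum_congr rfl fun i _ => ?_
      simp only [smul_smul, smul_eq_mul]
      congr 1; ring
    · have : f q = 0 := image_eq_zero_of_notMem_tsupport fun h => hq (hsub h)
      change (f q * f q) • Z q =
        ∑ i, (f q • e.localFrameCoeff 𝓘(ℝ, E) b i q (Z q)) • f q • e.localFrame b i q
      simp [this]

/-- Near every point there is a frame of global vector fields. -/
theorem exists_frame (p : M) :
    ∃ X : Fin (finrank ℝ E) → SmoothVectorField E M,
      (∀ᶠ q in 𝓝 p, ∃ B : Basis (Fin (finrank ℝ E)) ℝ (TangentSpace 𝓘(ℝ, E) q), ∀ i, B i = X i q) ∧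
      ∃ f : C^∞⟮𝓘(ℝ, E), M; 𝓘(ℝ, ℝ), ℝ⟯, f p = 1 ∧ ∀ Z : SmoothVectorField E M,
        ∃ c : Fin (finrank ℝ E) → C^∞⟮𝓘(ℝ, E), M; 𝓘(ℝ, ℝ), ℝ⟯,
          Z.fsmul f = ∑ i, (X i).fsmul (c i) := by
  obtain ⟨X, hX, hf⟩ := exists_localFrame (E := E) p
  refine ⟨X, ?_, hf⟩
  filter_upwards [hX, (trivializationAt E (TangentSpace 𝓘(ℝ, E)) p).open_baseSet.mem_nhds
    (FiberBundle.mem_baseSet_trivializationAt' p)] with q hq hq'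
  exact ⟨(trivializationAt E (TangentSpace 𝓘(ℝ, E)) p).basisAt (finBasis ℝ E) hq', fun i => by
    rw [hq i, Trivialization.localFrame_apply_of_mem_baseSet _ _ hq']⟩

theorem exists_eq (p : M) (v : TangentSpace 𝓘(ℝ, E) p) : ∃ X : SmoothVectorField E M, X p = v := by
  obtain ⟨X, hX, -⟩ := exists_frame (E := E) p
  obtain ⟨B, hB⟩ := hX.self_of_nhds
  refine ⟨∑ i, B.repr v i • X i, ?_⟩
  rw [sum_apply]
  conv_rhs => rw [← B.sum_repr v]
  simp [hB]

/-- A smooth vector field with a given value at a point. -/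
def extend (p : M) (v : TangentSpace 𝓘(ℝ, E) p) : SmoothVectorField E M := (exists_eq p v).choose

@[simp] theorem extend_apply (p : M) (v : TangentSpace 𝓘(ℝ, E) p) : extend p v p = v :=
  (exists_eq p v).choose_spec

end SmoothVectorField

variable {A : Type*} [AddCommGroup A] [Module ℝ A]

namespace IsTensorialAt

variable {φ : SmoothVectorField E M → A} {p : M}

/-- Multiplying a field by a function equal to 1 at `p` does not change `φ`, and the product is a
combination of the global fields `X i`. Hence `φ W` is determined by the coordinates of `W p` in the
frame. -/
theorem congr (h : IsTensorialAt φ p) {Y Z : SmoothVectorField E M} (hYZ : Y p = Z p) :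
    φ Y = φ Z := by
  obtain ⟨X, hX, f, hf, hc⟩ := SmoothVectorField.exists_frame (E := E) p
  obtain ⟨B, hB⟩ := hX.self_of_nhds
  have key (W : SmoothVectorField E M) : φ W = ∑ i, B.repr (W p) i • φ (X i) := by
    obtain ⟨c, hc⟩ := hc W
    have hW : W p = ∑ i, c i p • B i := by
      have := congrArg (fun V : SmoothVectorField E M => V p) hc
      simpa [hf, SmoothVectorField.sum_apply, hB] using this
    have h2 : φ W = ∑ i, c i p • φ (X i) := by
      have := congrArg φ hc
      rwa [h.map_fsmul, hf, one_smul, h.map_sum, Finset.sum_congr rfl fun i _ => h.map_fsmul _ _]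
        at this
    rw [h2]
    refine Finset.sum_congr rfl fun i _ => ?_
    rw [hW, B.repr_sum_self]
  rw [key, key Z, hYZ]

/-- The linear map on the tangent space which is induced by a tensorial map. -/
def toLinearMap (h : IsTensorialAt φ p) : TangentSpace 𝓘(ℝ, E) p →ₗ[ℝ] A where
  toFun v := φ (SmoothVectorField.extend p v)
  map_add' v w := by rw [← h.map_add]; exact h.congr (by simp)
  map_smul' c v := by
    rw [RingHom.id_apply, ← h.map_smul]; exact h.congr (by simp)

@[simp] theorem toLinearMap_apply (h : IsTensorialAt φ p) (X : SmoothVectorField E M) :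
    h.toLinearMap (X p) = φ X :=
  h.congr (by simp)

end IsTensorialAt

end Tensoriality

/-! ### Metric duality with smooth dependence -/

section Duality

theorem contMDiffAt_matrix_det {E : Type*} [NormedAddCommGroup E] [NormedSpace ℝ E]
    {M : Type*} [TopologicalSpace M] [ChartedSpace E M] {n : Type*} [Fintype n] [DecidableEq n] {A : M → Matrix n n ℝ}
    {p : M} (hA : ∀ i j, ContMDiffAt 𝓘(ℝ, E) 𝓘(ℝ, ℝ) ∞ (fun q => A q i j) p) :
    ContMDiffAt 𝓘(ℝ, E) 𝓘(ℝ, ℝ) ∞ (fun q => (A q).det) p := by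
  simp only [Matrix.det_apply']
  exact ContMDiffAt.sum fun σ _ => contMDiffAt_const.mul (contMDiffAt_finsetProd fun i _ => hA _ _)

open Filter Topology Module

variable {E : Type*} [NormedAddCommGroup E] [NormedSpace ℝ E]
  {M : Type*} [TopologicalSpace M] [ChartedSpace E M] [IsManifold 𝓘(ℝ, E) ∞ M]

variable (g : ContMDiffRiemannianMetric 𝓘(ℝ, E) ∞ E (TangentSpace 𝓘(ℝ, E) : M → Type _))

theorem contMDiff_metric (X Y : SmoothVectorField E M) :
    ContMDiff 𝓘(ℝ, E) 𝓘(ℝ, ℝ) ∞ (fun q => g.inner q (X q) (Y q)) := by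
  intro p
  have := ContMDiffAt.clm_bundle_apply₂ (F₁ := E) (F₂ := E) (F₃ := ℝ) (E₃ := Bundle.Trivial M ℝ)
    (b := id) g.contMDiff.contMDiffAt X.contMDiff.contMDiffAt (Y.contMDiff.contMDiffAt (x := p))
  exact (contMDiffAt_totalSpace.1 this).2

theorem metric_ext {p : M} {v w : TangentSpace 𝓘(ℝ, E) p}
    (h : ∀ u, g.inner p v u = g.inner p w u) : v = w := by
  by_contra hvw
  have := g.pos p (v - w) (sub_ne_zero.2 hvw)
  rw [(g.inner p).map_sub, sub_apply, h, sub_self] at this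
  exact this.false

/-- A kernel vector of the Gram matrix gives a vector orthogonal to the whole basis, hence to
itself, and so zero by positivity. -/
theorem metric_gram_det_ne_zero {ι : Type*} [Fintype ι] [DecidableEq ι] {p : M}
    (B : Basis ι ℝ (TangentSpace 𝓘(ℝ, E) p)) :
    (Matrix.of fun i j => g.inner p (B i) (B j)).det ≠ 0 := by
  intro h
  obtain ⟨v, hv, hv'⟩ := Matrix.exists_mulVec_eq_zero_iff.2 h
  set w := ∑ j, v j • B j with hw
  have hB (i) : g.inner p (B i) w = 0 := by
    have := congrFun hv' i
    simpa [Matrix.mulVec, dotProduct, hw, mul_comm] using this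
  have hw0 : w = 0 := by
    by_contra hne
    have := g.pos p w hne
    conv at this => rhs; arg 1; rw [hw]
    simp [hB] at this
  exact hv (funext fun i => Fintype.linearIndependent_iff.1 B.linearIndependent v hw0 i)

variable [FiniteDimensional ℝ E] [T2Space M]

/-- In a local frame the dual vector solves a linear system with the Gram matrix. Cramer's rule
expresses its coefficients by determinants, which makes them smooth. -/
theorem exists_local_metric_dual {φ : SmoothVectorField E M → M → ℝ}
    (hφ : ∀ Z, ContMDiff 𝓘(ℝ, E) 𝓘(ℝ, ℝ) ∞ (φ Z)) (ht : ∀ p, IsTensorialAt (φ · p) p) (p : M) :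
    ∃ W : (q : M) → TangentSpace 𝓘(ℝ, E) q,
      ContMDiffAt 𝓘(ℝ, E) (𝓘(ℝ, E).prod 𝓘(ℝ, E)) ∞ (fun q => TotalSpace.mk' E q (W q)) p ∧
      ∀ᶠ q in 𝓝 p, ∀ Z : SmoothVectorField E M, g.inner q (W q) (Z q) = φ Z q := by
  obtain ⟨X, hX, -⟩ := SmoothVectorField.exists_frame (E := E) p
  let G (q : M) : Matrix (Fin (finrank ℝ E)) (Fin (finrank ℝ E)) ℝ :=
    Matrix.of fun i j => g.inner q (X i q) (X j q)
  let c (q : M) (i) : ℝ := ((G q).det)⁻¹ * (G q).cramer (fun j => φ (X j) q) i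
  have hG {q : M} (hq : ∃ B : Basis (Fin (finrank ℝ E)) ℝ (TangentSpace 𝓘(ℝ, E) q),
      ∀ i, B i = X i q) : (G q).det ≠ 0 := by
    obtain ⟨B, hB⟩ := hq
    simpa only [hB] using metric_gram_det_ne_zero g B
  have hGs (i j) : ContMDiffAt 𝓘(ℝ, E) 𝓘(ℝ, ℝ) ∞ (fun q => G q i j) p :=
    (contMDiff_metric g (X i) (X j)).contMDiffAt
  have hc (i) : ContMDiffAt 𝓘(ℝ, E) 𝓘(ℝ, ℝ) ∞ (fun q => c q i) p := by
    refine ((contMDiffAt_matrix_det hGs).inv₀ (hG hX.self_of_nhds)).mul ?_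
    simp only [Matrix.cramer_apply]
    refine contMDiffAt_matrix_det fun k l => ?_
    by_cases hl : l = i
    · subst hl; simpa using (hφ (X k)).contMDiffAt
    · simpa [hl] using hGs k l
  refine ⟨fun q => ∑ i, c q i • X i q, ?_, ?_⟩
  · exact ContMDiffAt.sum_section fun i _ => (hc i).smul_section (X i).contMDiff.contMDiffAt
  · filter_upwards [hX] with q hq Z
    have hdet := hG hq
    have hframe (j) : g.inner q (∑ i, c q i • X i q) (X j q) = φ (X j) q := by
      have := congrFun ((G q).mulVec_cramer (fun j => φ (X j) q)) j
      simp only [Matrix.mulVec, dotProduct, Pi.smul_apply, smul_eq_mul] at this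
      have e : g.inner q (∑ i, c q i • X i q) (X j q) =
          ((G q).det)⁻¹ * ∑ i, G q j i * (G q).cramer (fun j => φ (X j) q) i := by
        simp only [map_sum, map_smul, _root_.sum_apply, _root_.smul_apply,
          smul_eq_mul, Finset.mul_sum]
        refine Finset.sum_congr rfl fun i _ => ?_
        simp only [c, G, Matrix.of_apply, g.symm q (X i q)]
        ring
      rw [e, this, inv_mul_cancel_left₀ hdet]
    obtain ⟨B, hB⟩ := hq
    obtain ⟨d, hd⟩ : ∃ d : Fin (finrank ℝ E) → ℝ, Z q = (∑ i, d i • X i) q := by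
      refine ⟨B.repr (Z q), ?_⟩
      rw [SmoothVectorField.sum_apply]
      conv_lhs => rw [← B.sum_repr (Z q)]
      simp [hB]
    have h1 : φ Z q = φ (∑ i, d i • X i) q := (ht q).congr hd
    rw [h1, (ht q).map_sum, hd, SmoothVectorField.sum_apply, map_sum]
    refine Finset.sum_congr rfl fun i _ => ?_
    rw [(ht q).map_smul, SmoothVectorField.smul_apply, map_smul, hframe]

/-- A `C^∞`-linear functional on vector fields is represented by a smooth vector field. -/
theorem exists_metric_dual {φ : SmoothVectorField E M → M → ℝ}
    (hφ : ∀ Z, ContMDiff 𝓘(ℝ, E) 𝓘(ℝ, ℝ) ∞ (φ Z)) (ht : ∀ p, IsTensorialAt (φ · p) p) :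
    ∃ V : SmoothVectorField E M, ∀ (Z : SmoothVectorField E M) (p : M),
      g.inner p (V p) (Z p) = φ Z p := by
  choose W hW hWφ using exists_local_metric_dual g hφ ht
  refine ⟨⟨fun p => W p p, fun p => ?_⟩, fun Z p => (hWφ p).self_of_nhds Z⟩
  -- Nondegeneracy makes the local duals agree where both represent `φ`, so the diagonal section
  -- coincides near `p` with the single local solution `W p`.
  refine (hW p).congr_of_eventuallyEq ?_
  filter_upwards [hWφ p] with q hq
  have : W q q = W p q := metric_ext g fun u => by
    have h1 := (hWφ q).self_of_nhds (SmoothVectorField.extend q u)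
    have h2 := hq (SmoothVectorField.extend q u)
    rw [SmoothVectorField.extend_apply] at h1 h2
    rw [h1, h2]
  simp [this]

end Duality

/-! ### Smoothness of bundle homomorphisms -/

section HomBundle

open Filter Topology Module

variable {E : Type*} [NormedAddCommGroup E] [NormedSpace ℝ E] [FiniteDimensional ℝ E]
  {M : Type*} [TopologicalSpace M] [T2Space M] [ChartedSpace E M] [IsManifold 𝓘(ℝ, E) ∞ M]
  {F : Type*} [NormedAddCommGroup F] [NormedSpace ℝ F] {V : M → Type*}
  [TopologicalSpace (TotalSpace F V)] [∀ p, AddCommGroup (V p)] [∀ p, Module ℝ (V p)]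
  [∀ p, TopologicalSpace (V p)] [FiberBundle F V] [VectorBundle ℝ F V]
  [∀ p, IsTopologicalAddGroup (V p)] [∀ p, ContinuousSMul ℝ (V p)]

/-- A section of a bundle of homomorphisms on the tangent bundle is smooth if it maps smooth vector
fields to smooth sections. -/
theorem contMDiff_hom_of_apply (Φ : (p : M) → TangentSpace 𝓘(ℝ, E) p →L[ℝ] V p)
    (h : ∀ X : SmoothVectorField E M,
      ContMDiff 𝓘(ℝ, E) (𝓘(ℝ, E).prod 𝓘(ℝ, F)) ∞ (fun p => TotalSpace.mk' F p (Φ p (X p)))) :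
    ContMDiff 𝓘(ℝ, E) (𝓘(ℝ, E).prod 𝓘(ℝ, E →L[ℝ] F)) ∞
      (fun p => TotalSpace.mk' (E →L[ℝ] F) (E := fun p : M => TangentSpace 𝓘(ℝ, E) p →L[ℝ] V p)
        p (Φ p)) := by
  intro p
  rw [contMDiffAt_hom_bundle]
  refine ⟨contMDiffAt_id, ?_⟩
  obtain ⟨X, hX, -⟩ := SmoothVectorField.exists_localFrame (E := E) p
  set b := finBasis ℝ E
  have h1 (i) : ContMDiffAt 𝓘(ℝ, E) 𝓘(ℝ, F) ∞
      (fun q => (trivializationAt F V p ⟨q, Φ q (X i q)⟩).2) p :=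
    (contMDiffAt_section p).1 (h (X i) p)
  -- Near `p`, the coordinate expression of `Φ` is the sum of the dual basis covectors tensored with
  -- the coordinates of `Φ (X i)`.
  have h2 : ContMDiffAt 𝓘(ℝ, E) 𝓘(ℝ, E →L[ℝ] F) ∞ (fun q => ∑ i,
      ContinuousLinearMap.smulRightL ℝ E F (LinearMap.toContinuousLinearMap (b.coord i))
        (trivializationAt F V p ⟨q, Φ q (X i q)⟩).2) p :=
    ContMDiffAt.sum fun i _ => ContMDiffAt.clm_apply contMDiffAt_const (h1 i)
  refine h2.congr_of_eventuallyEq ?_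
  filter_upwards [hX, (trivializationAt E (TangentSpace 𝓘(ℝ, E)) p).open_baseSet.mem_nhds
    (FiberBundle.mem_baseSet_trivializationAt' p), (trivializationAt F V p).open_baseSet.mem_nhds
    (FiberBundle.mem_baseSet_trivializationAt' p)] with q hq hq1 hq2
  rw [ContinuousLinearMap.inCoordinates_eq hq1 hq2]
  ext v
  conv_lhs => rw [← b.sum_repr v, map_sum]
  rw [_root_.sum_apply]
  refine Finset.sum_congr rfl fun i _ => ?_
  rw [map_smul]
  rw [hq i, Trivialization.localFrame_apply_of_mem_baseSet _ _ hq1]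
  simp [Trivialization.basisAt]

end HomBundle

/-! ### The Koszul expression and metric connections with given contorsion -/

section Koszul

variable {E : Type*} [NormedAddCommGroup E] [NormedSpace ℝ E]
  {M : Type*} [TopologicalSpace M] [ChartedSpace E M] [IsManifold 𝓘(ℝ, E) ∞ M]

namespace AlmostHermitianStructure

variable (S : AlmostHermitianStructure E M)

theorem contMDiff_gField (X Y : SmoothVectorField E M) :
    ContMDiff 𝓘(ℝ, E) 𝓘(ℝ, ℝ) ∞ (S.gField X Y) := contMDiff_metric S.metric X Y

theorem mdifferentiableAt_gField (X Y : SmoothVectorField E M) (p : M) :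
    MDifferentiableAt 𝓘(ℝ, E) 𝓘(ℝ, ℝ) (S.gField X Y) p :=
  (S.contMDiff_gField X Y).mdifferentiableAt (by simp)

theorem gField_comm (X Y : SmoothVectorField E M) : S.gField X Y = S.gField Y X :=
  funext fun p => S.metric.symm p _ _

theorem deriv_gField_add (X Y Z W : SmoothVectorField E M) (p : M) :
    X.deriv (S.gField Y (Z + W)) p = X.deriv (S.gField Y Z) p + X.deriv (S.gField Y W) p := by
  rw [← X.deriv_add (S.mdifferentiableAt_gField _ _ p) (S.mdifferentiableAt_gField _ _ p)]
  congr 1; funext q; simp [gField]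

theorem deriv_gField_fsmul (f : C^∞⟮𝓘(ℝ, E), M; 𝓘(ℝ, ℝ), ℝ⟯) (X Y Z : SmoothVectorField E M)
    (p : M) : X.deriv (S.gField Y (Z.fsmul f)) p =
      f p * X.deriv (S.gField Y Z) p + X.deriv f p * S.gField Y Z p := by
  rw [← X.deriv_mul f.mdifferentiableAt (S.mdifferentiableAt_gField _ _ p)]
  congr 1; funext q; simp [gField]

/-- The right-hand side of the Koszul formula for `2 g (∇_X Y, Z)`. -/
def koszul (X Y Z : SmoothVectorField E M) (p : M) : ℝ :=
  X.deriv (S.gField Y Z) p + Y.deriv (S.gField X Z) p - Z.deriv (S.gField X Y) p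
    + S.metric.inner p (X.bracket Y p) (Z p) - S.metric.inner p (X.bracket Z p) (Y p)
    - S.metric.inner p (Y.bracket Z p) (X p)

/-- This symmetrization encodes `∇g = 0`; the antisymmetrization in `koszul_sub_koszul_swap` encodes
the vanishing of the torsion. -/
theorem koszul_add_koszul_swap (X Y Z : SmoothVectorField E M) (p : M) :
    S.koszul X Y Z p + S.koszul X Z Y p = 2 * X.deriv (S.gField Y Z) p := by
  simp only [koszul, S.gField_comm Z Y, SmoothVectorField.bracket_swap Z Y, map_neg, neg_apply]
  ring

theorem koszul_sub_koszul_swap (X Y Z : SmoothVectorField E M) (p : M) :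
    S.koszul X Y Z p - S.koszul Y X Z p = 2 * S.metric.inner p (X.bracket Y p) (Z p) := by
  simp only [koszul, S.gField_comm Y X, SmoothVectorField.bracket_swap Y X, map_neg, neg_apply]
  ring

variable [FiniteDimensional ℝ E]

theorem contMDiff_koszul (X Y Z : SmoothVectorField E M) :
    ContMDiff 𝓘(ℝ, E) 𝓘(ℝ, ℝ) ∞ (S.koszul X Y Z) := by
  have hd (X Y Z : SmoothVectorField E M) := X.contMDiff_deriv (S.contMDiff_gField Y Z)
  have hb (X Y Z : SmoothVectorField E M) : ContMDiff 𝓘(ℝ, E) 𝓘(ℝ, ℝ) ∞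
      (fun p => S.metric.inner p (X.bracket Y p) (Z p)) :=
    contMDiff_metric S.metric ⟨_, X.contMDiff_bracket Y⟩ Z
  exact ((((hd X Y Z).add (hd Y X Z)).sub (hd Z X Y)).add (hb X Y Z)).sub (hb X Z Y)
    |>.sub (hb Y Z X)

theorem isTensorialAt_koszul_right (X Y : SmoothVectorField E M) (p : M) :
    IsTensorialAt (fun Z => S.koszul X Y Z p) p where
  map_add Z W := by
    simp only [koszul, deriv_gField_add, SmoothVectorField.bracket_add_right, map_add, add_apply,
      SmoothVectorField.add_apply, SmoothVectorField.deriv_add_left]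
    ring
  map_fsmul f Z := by
    simp only [koszul, deriv_gField_fsmul, SmoothVectorField.bracket_fsmul_right, map_add, add_apply,
      SmoothVectorField.fsmul_apply, SmoothVectorField.deriv_fsmul_left, map_smul, smul_apply, smul_eq_mul,
      gField, S.metric.symm p (Z p)]
    ring

theorem isTensorialAt_koszul_left (Y Z : SmoothVectorField E M) (p : M) :
    IsTensorialAt (fun X => S.koszul X Y Z p) p where
  map_add X W := by
    simp only [koszul, S.gField_comm (X + W), S.gField_comm X, S.gField_comm W,
      deriv_gField_add, SmoothVectorField.bracket_add_left, map_add, add_apply,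
      SmoothVectorField.add_apply, SmoothVectorField.deriv_add_left]
    ring
  map_fsmul f X := by
    simp only [koszul, S.gField_comm (X.fsmul f), S.gField_comm X, deriv_gField_fsmul,
      SmoothVectorField.bracket_fsmul_left, map_add, add_apply, map_neg, neg_apply,
      SmoothVectorField.fsmul_apply, SmoothVectorField.deriv_fsmul_left, map_smul, smul_apply, smul_eq_mul,
      gField, S.metric.symm p (X p)]
    ring

/-- The middle slot is reduced to the tensorial last slot by `koszul_add_koszul_swap`. In
`koszul_fsmul_mid` the same reduction produces the Leibniz term. -/
theorem koszul_add_mid (X Y W Z : SmoothVectorField E M) (p : M) :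
    S.koszul X (Y + W) Z p = S.koszul X Y Z p + S.koszul X W Z p := by
  have h := S.koszul_add_koszul_swap X (Y + W) Z p
  have h1 := S.koszul_add_koszul_swap X Y Z p
  have h2 := S.koszul_add_koszul_swap X W Z p
  have h3 := (S.isTensorialAt_koszul_right X Z p).map_add Y W
  rw [S.gField_comm, deriv_gField_add] at h
  rw [S.gField_comm] at h1 h2
  linarith

theorem koszul_fsmul_mid (f : C^∞⟮𝓘(ℝ, E), M; 𝓘(ℝ, ℝ), ℝ⟯) (X Y Z : SmoothVectorField E M) (p : M) :
    S.koszul X (Y.fsmul f) Z p = f p * S.koszul X Y Z p + 2 * (X.deriv f p * S.gField Y Z p) := by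
  have h := S.koszul_add_koszul_swap X (Y.fsmul f) Z p
  have h1 := S.koszul_add_koszul_swap X Y Z p
  have h3 := (S.isTensorialAt_koszul_right X Z p).map_fsmul f Y
  rw [S.gField_comm, deriv_gField_fsmul] at h
  rw [S.gField_comm] at h1
  rw [smul_eq_mul] at h3
  rw [S.gField_comm Y Z]
  linear_combination h - h3 - f p * h1

variable [T2Space M]

/-- The metric connection with prescribed contorsion. -/
theorem exists_connection {τ : SmoothVectorField E M → SmoothVectorField E M →
      SmoothVectorField E M → M → ℝ}
    (hs : ∀ X Y Z, ContMDiff 𝓘(ℝ, E) 𝓘(ℝ, ℝ) ∞ (τ X Y Z))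
    (hX : ∀ Y Z p, IsTensorialAt (fun X => τ X Y Z p) p)
    (hY : ∀ X Z p, IsTensorialAt (fun Y => τ X Y Z p) p)
    (hτ : ∀ X Y Z p, τ X Z Y p = -τ X Y Z p) :
    ∃ D : SmoothConnection E M, D.IsMetric S ∧ ∀ X Y Z p,
      2 * S.metric.inner p (D.toFun X Y p) (Z p) = S.koszul X Y Z p + τ X Y Z p := by
  -- Skewness in the last two slots transfers tensoriality from `Y` to `Z`.
  have hZ (X Y p) : IsTensorialAt (fun Z => τ X Y Z p) p :=
    ⟨fun Z W => by rw [hτ X Z, hτ X W, hτ X (Z + W), (hY X Y p).map_add, neg_add], fun f Z => by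
      rw [hτ X Z, hτ X (Z.fsmul f), (hY X Y p).map_fsmul, smul_neg]⟩
  have key (X Y) := exists_metric_dual S.metric
    (φ := fun Z p => (1 / 2 : ℝ) * (S.koszul X Y Z p + τ X Y Z p))
    (fun Z => contMDiff_const.mul ((S.contMDiff_koszul X Y Z).add (hs X Y Z)))
    (fun p => ⟨fun Z W => by
        rw [(S.isTensorialAt_koszul_right X Y p).map_add, (hZ X Y p).map_add]; ring,
      fun f Z => by
        rw [(S.isTensorialAt_koszul_right X Y p).map_fsmul, (hZ X Y p).map_fsmul]
        simp only [smul_eq_mul]; ring⟩)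
  choose D hD using key
  have ext {p : M} {v w : TangentSpace 𝓘(ℝ, E) p}
      (h : ∀ Z : SmoothVectorField E M, S.metric.inner p v (Z p) = S.metric.inner p w (Z p)) :
      v = w := metric_ext S.metric fun u => by simpa using h (SmoothVectorField.extend p u)
  refine ⟨⟨D, fun X X' Y => ?_, fun f X Y => ?_, fun X Y Y' => ?_, fun f X Y p => ?_⟩, ?_, ?_⟩
  · refine ContMDiffSection.ext fun p => ext fun Z => ?_
    simp only [SmoothVectorField.add_apply, map_add, add_apply, hD,
      (S.isTensorialAt_koszul_left Y Z p).map_add, (hX Y Z p).map_add]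
    ring
  · refine ContMDiffSection.ext fun p => ext fun Z => ?_
    simp only [SmoothVectorField.fsmul_apply, map_smul, smul_apply, hD, smul_eq_mul,
      (S.isTensorialAt_koszul_left Y Z p).map_fsmul, (hX Y Z p).map_fsmul]
    ring
  · refine ContMDiffSection.ext fun p => ext fun Z => ?_
    simp only [SmoothVectorField.add_apply, map_add, add_apply, hD, koszul_add_mid,
      (hY X Z p).map_add]
    ring
  · refine ext fun Z => ?_
    simp only [map_add, add_apply, map_smul, smul_apply, hD, smul_eq_mul, koszul_fsmul_mid,
      (hY X Z p).map_fsmul, gField]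
    ring
  · intro X Y Z p
    have := S.koszul_add_koszul_swap X Y Z p
    simp only [gField, S.metric.symm p (Y p), hD, hτ X Y Z]
    linarith
  · intro X Y Z p
    simp only [hD]
    ring

end AlmostHermitianStructure

end Koszul

/-! ### Pointwise algebra of types and torsion -/

section Algebra

variable {V : Type*} [AddCommGroup V] [Module ℝ V]

/-- The mixed part is `η` minus its (3,0)- and (0,3)-parts, whose sum is one quarter of `η(X,Y,Z) -
η(X,JY,JZ) - η(JX,Y,JZ) - η(JX,JY,Z)`. -/
theorem mixedPart_eq (J : V → V) {η : V → V → V → ℝ}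
    (h₁ : ∀ (c : ℝ) X Y Z, η (c • X) Y Z = c * η X Y Z)
    (h₂ : ∀ (c : ℝ) X Y Z, η X (c • Y) Z = c * η X Y Z)
    (h₃ : ∀ (c : ℝ) X Y Z, η X Y (c • Z) = c * η X Y Z) (X Y Z : V) :
    mixedPart J η X Y Z = 3 / 4 * η X Y Z
      + 1 / 4 * (η X (J Y) (J Z) + η (J X) Y (J Z) + η (J X) (J Y) Z) := by
  simp only [mixedPart, complexTrilin, holPart, antiholPart, Complex.add_re, ← neg_smul, h₁, h₂, h₃]
  ring

/-- The real component of the (2,0)-part is `(B(X,Y) - B(JX,JY))/4`; once it vanishes identically,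
replacing `X` by `JX` kills the imaginary component. -/
theorem isType11_iff {W : Type*} [AddCommGroup W] [Module ℝ W] {J : V → V} (hJ : ∀ X, J (J X) = -X)
    {B : V → V → W}
    (h₁ : ∀ (c : ℝ) X Y, B (c • X) Y = c • B X Y) (h₂ : ∀ (c : ℝ) X Y, B X (c • Y) = c • B X Y) :
    IsType11 J B ↔ ∀ X Y, B (J X) (J Y) = B X Y := by
  have key (X Y : V) : (B (J X) (J Y) = B X Y) ↔
      (1 / 4 : ℝ) • B X Y - (1 / 4 : ℝ) • B (J X) (J Y) = 0 := by
    rw [← smul_sub, smul_eq_zero_iff_right (by norm_num), sub_eq_zero, eq_comm]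
  have neg₁ (X Y : V) : B (-X) Y = -B X Y := by simpa using h₁ (-1) X Y
  have e (x y : W) : (1 / 2 : ℝ) • (1 / 2 : ℝ) • x - (1 / 2 : ℝ) • (1 / 2 : ℝ) • y =
      (1 / 4 : ℝ) • x - (1 / 4 : ℝ) • y := by simp only [smul_smul]; norm_num
  simp only [IsType11, complexBilin, holPart, antiholPart, ← neg_smul, h₁, h₂, Prod.mk_eq_zero]
  constructor
  · intro h X Y
    rw [key, ← e]
    exact (h X Y).2.1
  · intro h X Y
    have h0 := (key X Y).1 (h X Y)
    rw [← e] at h0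
    have h1 : B (J X) Y = -B X (J Y) := by
      have h2 := h (J X) Y
      rw [← h2, hJ, neg₁]
    refine ⟨⟨?_, ?_⟩, h0, ?_⟩
    · rw [← h0]; module
    · rw [h1]; module
    · rw [h1]; module

omit [Module ℝ V] in
theorem map_neg_of_sq_eq_neg {J : V → V} (hJ : ∀ X, J (J X) = -X) (X : V) : J (-X) = -J X := by
  rw [← hJ X, hJ]

/-- The algebraic relations between `F (X, Y, Z) = g ((∇_X J) Y, Z)`, for the Levi-Civita connection
`∇`, the exterior derivative `η` of the fundamental form, its mixed part `η'` and the Nijenhuis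
tensor `N`. -/
structure HermitianRelations (J : V → V) (F η η' N : V → V → V → ℝ) : Prop where
  J_J (X : V) : J (J X) = -X
  neg_left (X Y Z : V) : F (-X) Y Z = -F X Y Z
  neg_right (X Y Z : V) : F X Y (-Z) = -F X Y Z
  swap (X Y Z : V) : F X Z Y = -F X Y Z
  J_mid (X Y Z : V) : F X (J Y) Z = F X Y (J Z)
  eta (X Y Z : V) : η X Y Z = F X Y Z + F Y Z X + F Z X Y
  eta_mixed (X Y Z : V) : η' X Y Z = 3 / 4 * η X Y Z
    + 1 / 4 * (η X (J Y) (J Z) + η (J X) Y (J Z) + η (J X) (J Y) Z)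
  nijenhuis (X Y Z : V) : N X Y Z = -F X Y (J Z) + F Y X (J Z) - F (J X) Y Z + F (J Y) X Z

/-- The algebraic properties of `a (X, Y, Z) = g (α (X, Y), Z)` for a form `α` of type `(1,1)`. -/
structure Relations11 (J : V → V) (a : V → V → V → ℝ) : Prop where
  neg_mid (X Y Z : V) : a X (-Y) Z = -a X Y Z
  neg_right (X Y Z : V) : a X Y (-Z) = -a X Y Z
  swap (X Y Z : V) : a Y X Z = -a X Y Z
  J_left (X Y Z : V) : a (J X) Y Z = -a X (J Y) Z

/-- The prescribed torsion. -/
def prescribedTorsion (J : V → V) (η' N a : V → V → V → ℝ) (X Y Z : V) : ℝ :=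
  -(1 / 4) * N X Y Z - (1 / 2) * η' (J X) (J Y) (J Z) + (1 / 2) * η' X Y (J Z)
    + (1 / 2) * (a X Y Z + a Y Z X + a Z X Y)
    - (1 / 2) * (a (J X) (J Y) Z + a (J Y) Z (J X) + a Z (J X) (J Y)) + a X Y Z

namespace HermitianRelations

variable {J : V → V} {F η η' N T a : V → V → V → ℝ}

omit [Module ℝ V] in
theorem neg_mid (h : HermitianRelations J F η η' N) (X Y Z : V) : F X (-Y) Z = -F X Y Z := by
  rw [h.swap, h.neg_right, h.swap X Y, neg_neg]

omit [Module ℝ V] in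
theorem J_right_swap (h : HermitianRelations J F η η' N) (X Y Z : V) :
    F X Z (J Y) = -F X Y (J Z) := by rw [h.swap, h.J_mid]

omit [Module ℝ V] in
theorem _root_.Relations11.neg_left (ha : Relations11 J a) (X Y Z : V) : a (-X) Y Z = -a X Y Z := by
  rw [ha.swap, ha.neg_mid, ha.swap Y X]

omit [Module ℝ V] in
theorem _root_.Relations11.J_mid_swap (ha : Relations11 J a) (X Y Z : V) :
    a Y (J X) Z = a X (J Y) Z := by rw [ha.swap, ha.J_left, neg_neg]

omit [Module ℝ V] in
-- Skewness is what allows this expression to be the torsion of a connection.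
theorem prescribedTorsion_swap (h : HermitianRelations J F η η' N) (ha : Relations11 J a)
    (X Y Z : V) : prescribedTorsion J η' N a Y X Z = -prescribedTorsion J η' N a X Y Z := by
  simp only [prescribedTorsion, h.nijenhuis, h.eta_mixed, h.eta, h.J_mid, ha.J_left, h.J_J,
    map_neg_of_sq_eq_neg h.J_J, h.neg_left, h.neg_mid, h.neg_right, ha.neg_mid]
  -- With `J` already pushed to the right in `F` and out of the first slot of `a`, the skew
  -- symmetries select one representative of each term, leaving a linear identity.
  simp only [h.swap _ X Y, h.swap _ X Z, h.swap _ Y Z,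
    h.J_right_swap _ X Y, h.J_right_swap _ X Z, h.J_right_swap _ Y Z,
    ha.swap X Y, ha.swap X Z, ha.swap Y Z, ha.J_mid_swap X Z, ha.J_mid_swap Y Z]
  ring

omit [Module ℝ V] in
-- Replacing `(X,Y)` by `(JX,JY)` changes the sign of the `N` term, of the combined `dω⁺` terms and
-- of the combined `α⁺` terms, whereas `a` is invariant.
theorem prescribedTorsion_add_J (h : HermitianRelations J F η η' N) (ha : Relations11 J a)
    (X Y Z : V) :
    prescribedTorsion J η' N a X Y Z + prescribedTorsion J η' N a (J X) (J Y) Z = 2 * a X Y Z := by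
  simp only [prescribedTorsion, h.nijenhuis, h.eta_mixed, h.eta, h.J_mid, ha.J_left, h.J_J,
    map_neg_of_sq_eq_neg h.J_J, h.neg_left, h.neg_mid, h.neg_right, ha.neg_left, ha.neg_mid, ha.neg_right]
  ring

omit [Module ℝ V] in
/-- A metric connection with the prescribed torsion preserves `J`. -/
theorem preservesJ_of_prescribedTorsion (h : HermitianRelations J F η η' N) (ha : Relations11 J a)
    (X Y Z : V) :
    2 * F X Y Z
      + (prescribedTorsion J η' N a X (J Y) Z - prescribedTorsion J η' N a X Z (J Y)
        - prescribedTorsion J η' N a (J Y) Z X)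
      + (prescribedTorsion J η' N a X Y (J Z) - prescribedTorsion J η' N a X (J Z) Y
        - prescribedTorsion J η' N a Y (J Z) X) = 0 := by
  simp only [prescribedTorsion, h.nijenhuis, h.eta_mixed, h.eta, h.J_mid, ha.J_left, h.J_J,
    map_neg_of_sq_eq_neg h.J_J, h.neg_left, h.neg_mid, h.neg_right, ha.neg_left, ha.neg_mid, ha.neg_right]
  simp only [h.swap _ X Y, h.swap _ X Z, h.swap _ Y Z,
    h.J_right_swap _ X Y, h.J_right_swap _ X Z, h.J_right_swap _ Y Z,
    ha.swap X Y, ha.swap X Z, ha.swap Y Z, ha.J_mid_swap X Y, ha.J_mid_swap X Z, ha.J_mid_swap Y Z]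
  ring

omit [Module ℝ V] in
/-- The torsion of a Hermitian connection is the one prescribed by its `(1,1)`-part. -/
theorem eq_prescribedTorsion (h : HermitianRelations J F η η' N)
    (hT₁ : ∀ X Y Z, T (-X) Y Z = -T X Y Z) (hT₃ : ∀ X Y Z, T X Y (-Z) = -T X Y Z)
    (hT : ∀ X Y Z, T Y X Z = -T X Y Z)
    (hF : ∀ X Y Z, 2 * F X Y Z + (T X (J Y) Z - T X Z (J Y) - T (J Y) Z X)
      + (T X Y (J Z) - T X (J Z) Y - T Y (J Z) X) = 0)
    (ha : ∀ X Y Z, a X Y Z = 1 / 2 * (T X Y Z + T (J X) (J Y) Z)) (X Y Z : V) :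
    T X Y Z = prescribedTorsion J η' N a X Y Z := by
  have hT₂ (X Y Z) : T X (-Y) Z = -T X Y Z := by rw [hT, hT₁, hT Y X]
  -- The equation `∇J = 0` is solved for `F`, so that `η'`, `N` and `a` all become expressions in
  -- `T`; skewness of `T` then suffices.
  have hF' (X Y Z) : F X Y Z = -(1 / 2) * ((T X (J Y) Z - T X Z (J Y) - T (J Y) Z X)
      + (T X Y (J Z) - T X (J Z) Y - T Y (J Z) X)) := by linarith [hF X Y Z]
  simp only [prescribedTorsion, h.nijenhuis, h.eta_mixed, h.eta, hF', ha, h.J_J,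
    map_neg_of_sq_eq_neg h.J_J, hT₁, hT₂, hT₃,
    hT X Y, hT Y Z, hT X Z, hT X (J Y), hT X (J Z), hT Y (J X), hT Y (J Z), hT Z (J X),
    hT Z (J Y), hT (J X) (J Y), hT (J Y) (J Z), hT (J X) (J Z)]
  ring

end HermitianRelations

end Algebra

/-! ### The covariant derivative of `J`, and its relation to `dω`, `N` and torsion -/

section Connections

variable {E : Type*} [NormedAddCommGroup E] [NormedSpace ℝ E]
  {M : Type*} [TopologicalSpace M] [ChartedSpace E M] [IsManifold 𝓘(ℝ, E) ∞ M]

namespace AlmostHermitianStructure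

variable (S : AlmostHermitianStructure E M)

@[simp] theorem JField_apply (X : SmoothVectorField E M) (p : M) : S.JField X p = S.J p (X p) := rfl

theorem JField_JField (X : SmoothVectorField E M) : S.JField (S.JField X) = -X :=
  ContMDiffSection.ext fun p => S.J_J p (X p)

theorem JField_add (X Y : SmoothVectorField E M) : S.JField (X + Y) = S.JField X + S.JField Y :=
  ContMDiffSection.ext fun p => map_add (S.J p) _ _

theorem JField_fsmul (f : C^∞⟮𝓘(ℝ, E), M; 𝓘(ℝ, ℝ), ℝ⟯) (X : SmoothVectorField E M) :
    S.JField (X.fsmul f) = (S.JField X).fsmul f :=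
  ContMDiffSection.ext fun p => map_smul (S.J p) _ _

theorem metric_J_left (p : M) (v w : TangentSpace 𝓘(ℝ, E) p) :
    S.metric.inner p (S.J p v) w = -S.metric.inner p v (S.J p w) := by
  rw [← S.metric_J, S.J_J, map_neg, neg_apply]

theorem gField_JField (X Y : SmoothVectorField E M) :
    S.gField (S.JField X) Y = fun p => -S.gField X (S.JField Y) p :=
  funext fun p => S.metric_J_left p _ _

end AlmostHermitianStructure

namespace SmoothConnection

variable (D : SmoothConnection E M)

theorem map_neg_right (X Y : SmoothVectorField E M) : D.toFun X (-Y) = -D.toFun X Y := by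
  have h0 : D.toFun X 0 = 0 := by simpa using D.add_right X 0 0
  have := D.add_right X Y (-Y)
  rw [add_neg_cancel, h0] at this
  exact (neg_eq_of_add_eq_zero_right this.symm).symm

variable {D} {S : AlmostHermitianStructure E M}

theorem torsion_swap (X Y : SmoothVectorField E M) (p : M) : D.torsion Y X p = -D.torsion X Y p := by
  simp only [torsion, SmoothVectorField.bracket_swap Y X]
  abel

namespace IsMetric

variable (h : D.IsMetric S)
include h

theorem deriv_gField (X Y Z : SmoothVectorField E M) (p : M) : X.deriv (S.gField Y Z) p =
    S.metric.inner p (D.toFun X Y p) (Z p) + S.metric.inner p (D.toFun X Z p) (Y p) := by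
  have := h X Y Z p
  simp only [AlmostHermitianStructure.gField, S.metric.symm p (Y p)] at this
  linarith

theorem koszul_formula (X Y Z : SmoothVectorField E M) (p : M) :
    2 * S.metric.inner p (D.toFun X Y p) (Z p) = S.koszul X Y Z p
      + (S.metric.inner p (D.torsion X Y p) (Z p) - S.metric.inner p (D.torsion X Z p) (Y p)
        - S.metric.inner p (D.torsion Y Z p) (X p)) := by
  simp only [AlmostHermitianStructure.koszul, h.deriv_gField, torsion, map_sub, sub_apply]
  ring

end IsMetric

/-- `g ((∇_X J) Y, Z)`. -/
def covDerivJ (D : SmoothConnection E M) (S : AlmostHermitianStructure E M)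
    (X Y Z : SmoothVectorField E M) (p : M) : ℝ :=
  S.metric.inner p (D.toFun X (S.JField Y) p) (Z p)
    + S.metric.inner p (D.toFun X Y p) (S.JField Z p)

theorem covDerivJ_J_mid (X Y Z : SmoothVectorField E M) (p : M) :
    D.covDerivJ S X (S.JField Y) Z p = D.covDerivJ S X Y (S.JField Z) p := by
  simp only [covDerivJ, S.JField_JField, D.map_neg_right, SmoothVectorField.neg_apply, map_neg,
    neg_apply]
  ring

/-- Differentiate `g(JY,Z) = -g(Y,JZ)` along `X` with a metric connection. -/
theorem IsMetric.covDerivJ_swap (h : D.IsMetric S) (X Y Z : SmoothVectorField E M) (p : M) :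
    D.covDerivJ S X Z Y p = -D.covDerivJ S X Y Z p := by
  have h1 := h.deriv_gField X (S.JField Y) Z p
  have h2 := h.deriv_gField X Y (S.JField Z) p
  rw [S.gField_JField] at h1
  have h3 : X.deriv (fun p => -S.gField Y (S.JField Z) p) p = -X.deriv (S.gField Y (S.JField Z)) p := by
    have := X.deriv_mul (mdifferentiableAt_const (c := (-1 : ℝ))) (S.mdifferentiableAt_gField Y (S.JField Z) p)
    simpa [X.deriv_const] using this
  simp only [covDerivJ]
  linarith

theorem IsMetric.dOmega_eq (h : D.IsMetric S) (hT : ∀ X Y p, D.torsion X Y p = 0)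
    (X Y Z : SmoothVectorField E M) (p : M) :
    S.dOmega X Y Z p = D.covDerivJ S X Y Z p + D.covDerivJ S Y Z X p + D.covDerivJ S Z X Y p := by
  have hb (X Y : SmoothVectorField E M) : X.bracket Y p = D.toFun X Y p - D.toFun Y X p := by
    have := hT X Y p
    rw [torsion, sub_eq_zero] at this
    exact this.symm
  have hd (X Y Z : SmoothVectorField E M) : X.deriv (S.omegaField Y Z) p =
    S.metric.inner p (D.toFun X (S.JField Y) p) (Z p) + S.metric.inner p (D.toFun X Z p) (S.JField Y p) :=
    h.deriv_gField X (S.JField Y) Z p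
  have h1 := h.covDerivJ_swap Y X Z p
  simp only [AlmostHermitianStructure.dOmega, hd, hb, AlmostHermitianStructure.omega, map_sub,
    sub_apply, covDerivJ, S.metric_J_left, S.JField_apply] at h1 ⊢
  linarith

theorem inner_nijenhuis_eq (hT : ∀ X Y p, D.torsion X Y p = 0)
    (X Y Z : SmoothVectorField E M) (p : M) :
    S.metric.inner p (S.nijenhuis X Y p) (Z p) =
      -D.covDerivJ S X Y (S.JField Z) p + D.covDerivJ S Y X (S.JField Z) p
        - D.covDerivJ S (S.JField X) Y Z p + D.covDerivJ S (S.JField Y) X Z p := by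
  have hb (X Y : SmoothVectorField E M) : X.bracket Y p = D.toFun X Y p - D.toFun Y X p := by
    have := hT X Y p
    rw [torsion, sub_eq_zero] at this
    exact this.symm
  simp only [AlmostHermitianStructure.nijenhuis, hb, map_sub, map_add, sub_apply, add_apply,
    covDerivJ, S.metric_J_left, S.JField_JField, SmoothVectorField.neg_apply, map_neg, S.JField_apply]
  ring

theorem isTensorialAt_covDerivJ_left (Y Z : SmoothVectorField E M) (p : M) :
    IsTensorialAt (fun X => D.covDerivJ S X Y Z p) p :=
  ⟨fun X X' => by
    simp only [covDerivJ, D.add_left, SmoothVectorField.add_apply, map_add, add_apply]; ring,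
  fun f X => by
    simp only [covDerivJ, D.fsmul_left, SmoothVectorField.fsmul_apply, map_smul, smul_apply,
      smul_eq_mul]; ring⟩

theorem isTensorialAt_covDerivJ_right (X Y : SmoothVectorField E M) (p : M) :
    IsTensorialAt (fun Z => D.covDerivJ S X Y Z p) p :=
  ⟨fun Z Z' => by
    simp only [covDerivJ, S.JField_add, SmoothVectorField.add_apply, map_add]; ring,
  fun f X => by
    simp only [covDerivJ, S.JField_fsmul, SmoothVectorField.fsmul_apply, map_smul, smul_eq_mul]; ring⟩

theorem IsMetric.isTensorialAt_covDerivJ_mid (h : D.IsMetric S) (X Z : SmoothVectorField E M) (p : M) :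
    IsTensorialAt (fun Y => D.covDerivJ S X Y Z p) p := by
  have hsw (Y : SmoothVectorField E M) := h.covDerivJ_swap X Z Y p
  simp only [hsw]
  have ht := isTensorialAt_covDerivJ_right (D := D) (S := S) X Z p
  exact ⟨fun Y Y' => by rw [ht.map_add, neg_add], fun f Y => by rw [ht.map_fsmul, smul_neg]⟩

theorem contMDiff_covDerivJ (X Y Z : SmoothVectorField E M) :
    ContMDiff 𝓘(ℝ, E) 𝓘(ℝ, ℝ) ∞ (D.covDerivJ S X Y Z) :=
  (S.contMDiff_gField (D.toFun X (S.JField Y)) Z).add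
    (S.contMDiff_gField (D.toFun X Y) (S.JField Z))

/-- Bridge to the algebra: the space of vector fields plays the role of `V`, and all forms are
evaluated at the fixed point `p`. -/
theorem IsMetric.hermitianRelations (h : D.IsMetric S) (hT : ∀ X Y p, D.torsion X Y p = 0) (p : M) :
    HermitianRelations S.JField (fun X Y Z => D.covDerivJ S X Y Z p)
      (fun X Y Z => S.dOmega X Y Z p) (fun X Y Z => S.dOmegaPlus X Y Z p)
      (fun X Y Z => S.metric.inner p (S.nijenhuis X Y p) (Z p)) where
  J_J := S.JField_JField
  neg_left X Y Z := (isTensorialAt_covDerivJ_left Y Z p).map_neg X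
  neg_right X Y Z := (isTensorialAt_covDerivJ_right X Y p).map_neg Z
  swap X Y Z := h.covDerivJ_swap X Y Z p
  J_mid X Y Z := covDerivJ_J_mid X Y Z p
  eta X Y Z := h.dOmega_eq hT X Y Z p
  eta_mixed X Y Z := by
    have h₁ (Y Z) := (isTensorialAt_covDerivJ_left (D := D) (S := S) Y Z p).map_smul
    have h₂ (X Z) := (h.isTensorialAt_covDerivJ_mid X Z p).map_smul
    have h₃ (X Y) := (isTensorialAt_covDerivJ_right (D := D) (S := S) X Y p).map_smul
    simp only [smul_eq_mul] at h₁ h₂ h₃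
    refine mixedPart_eq _ ?_ ?_ ?_ X Y Z <;> intro c X Y Z <;>
      simp only [h.dOmega_eq hT, h₁, h₂, h₃] <;> ring
  nijenhuis X Y Z := inner_nijenhuis_eq hT X Y Z p

/-- The obstruction to `D J = 0` in terms of the torsion of a metric connection `D`. -/
theorem IsMetric.two_mul_covDerivJ (h : D.IsMetric S) {D₀ : SmoothConnection E M}
    (h₀ : D₀.IsMetric S) (hT₀ : ∀ X Y p, D₀.torsion X Y p = 0)
    {t : SmoothVectorField E M → SmoothVectorField E M → SmoothVectorField E M → ℝ} {p : M}
    (ht : ∀ X Y Z, S.metric.inner p (D.torsion X Y p) (Z p) = t X Y Z)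
    (X Y Z : SmoothVectorField E M) :
    2 * D.covDerivJ S X Y Z p = 2 * D₀.covDerivJ S X Y Z p
      + (t X (S.JField Y) Z - t X Z (S.JField Y) - t (S.JField Y) Z X)
      + (t X Y (S.JField Z) - t X (S.JField Z) Y - t Y (S.JField Z) X) := by
  -- The Koszul expressions depend only on `g`, so they cancel between `D` and `D₀`; only the
  -- contorsion of `D` survives.
  have h1 := h.koszul_formula X (S.JField Y) Z p
  have h2 := h.koszul_formula X Y (S.JField Z) p
  have h3 := h₀.koszul_formula X (S.JField Y) Z p
  have h4 := h₀.koszul_formula X Y (S.JField Z) p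
  simp only [hT₀, map_zero, zero_apply] at h3 h4
  simp only [ht] at h1 h2
  simp only [covDerivJ]
  linarith

variable [FiniteDimensional ℝ E] [T2Space M]

theorem PreservesJ_iff (D : SmoothConnection E M) (S : AlmostHermitianStructure E M) :
    D.PreservesJ S ↔ ∀ X Y Z p, D.covDerivJ S X Y Z p = 0 := by
  have key (X Y Z : SmoothVectorField E M) (p : M) : D.covDerivJ S X Y Z p =
      S.metric.inner p ((D.toFun X (S.JField Y) - S.JField (D.toFun X Y)) p) (Z p) := by
    simp [covDerivJ, S.metric_J_left]
  constructor
  · intro h X Y Z p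
    rw [key, h X Y]
    simp
  · intro h X Y
    refine ContMDiffSection.ext fun p => metric_ext S.metric fun u => ?_
    have := h X Y (SmoothVectorField.extend p u) p
    rw [key, SmoothVectorField.extend_apply] at this
    simpa using this

theorem _root_.AlmostHermitianStructure.exists_leviCivita (S : AlmostHermitianStructure E M) :
    ∃ D : SmoothConnection E M, D.IsMetric S ∧ ∀ X Y p, D.torsion X Y p = 0 := by
  obtain ⟨D, hD, h⟩ := S.exists_connection (τ := fun _ _ _ _ => 0) (fun _ _ _ => contMDiff_const)
    (fun _ _ _ => ⟨by simp, by simp⟩) (fun _ _ _ => ⟨by simp, by simp⟩) (by simp)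
  refine ⟨D, hD, fun X Y p => metric_ext S.metric fun u => ?_⟩
  have h1 := h X Y (SmoothVectorField.extend p u) p
  have h2 := h Y X (SmoothVectorField.extend p u) p
  have h3 := S.koszul_sub_koszul_swap X Y (SmoothVectorField.extend p u) p
  rw [SmoothVectorField.extend_apply] at h1 h2 h3
  simp only [torsion, map_sub, sub_apply, map_zero, zero_apply]
  linarith

end SmoothConnection

end Connections

/-! ### Smooth tensors and the tensoriality of the prescribed torsion -/

section Tensors

variable {E : Type*} [NormedAddCommGroup E] [NormedSpace ℝ E]
  {M : Type*} [TopologicalSpace M] [ChartedSpace E M] [IsManifold 𝓘(ℝ, E) ∞ M]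

/-- Smooth functions which depend `C^∞`-trilinearly on three vector fields. -/
structure IsTensor₃ (t : SmoothVectorField E M → SmoothVectorField E M → SmoothVectorField E M →
    M → ℝ) : Prop where
  contMDiff (X Y Z) : ContMDiff 𝓘(ℝ, E) 𝓘(ℝ, ℝ) ∞ (t X Y Z)
  left (Y Z p) : IsTensorialAt (fun X => t X Y Z p) p
  mid (X Z p) : IsTensorialAt (fun Y => t X Y Z p) p
  right (X Y p) : IsTensorialAt (fun Z => t X Y Z p) p

theorem IsTensorialAt.add {A : Type*} [AddCommGroup A] [Module ℝ A] {φ ψ : SmoothVectorField E M → A}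
    {p : M} (h : IsTensorialAt φ p) (h' : IsTensorialAt ψ p) :
    IsTensorialAt (fun X => φ X + ψ X) p :=
  ⟨fun X Y => by rw [h.map_add, h'.map_add]; abel, fun f X => by
    rw [h.map_fsmul, h'.map_fsmul, smul_add]⟩

theorem IsTensorialAt.const_smul {A : Type*} [AddCommGroup A] [Module ℝ A]
    {φ : SmoothVectorField E M → A} {p : M} (h : IsTensorialAt φ p) (c : ℝ) :
    IsTensorialAt (fun X => c • φ X) p :=
  ⟨fun X Y => by rw [h.map_add, smul_add], fun f X => by rw [h.map_fsmul, smul_comm]⟩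

theorem IsTensorialAt.comp_JField {A : Type*} [AddCommGroup A] [Module ℝ A]
    {φ : SmoothVectorField E M → A} {p : M} (h : IsTensorialAt φ p)
    (S : AlmostHermitianStructure E M) : IsTensorialAt (fun X => φ (S.JField X)) p :=
  ⟨fun X Y => by rw [S.JField_add, h.map_add], fun f X => by rw [S.JField_fsmul, h.map_fsmul]⟩

namespace IsTensor₃

variable {t t' : SmoothVectorField E M → SmoothVectorField E M → SmoothVectorField E M → M → ℝ}

theorem add (h : IsTensor₃ t) (h' : IsTensor₃ t') :
    IsTensor₃ (fun X Y Z p => t X Y Z p + t' X Y Z p) where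
  contMDiff X Y Z := (h.contMDiff X Y Z).add (h'.contMDiff X Y Z)
  left Y Z p := (h.left Y Z p).add (h'.left Y Z p)
  mid X Z p := (h.mid X Z p).add (h'.mid X Z p)
  right X Y p := (h.right X Y p).add (h'.right X Y p)

theorem const_mul (h : IsTensor₃ t) (c : ℝ) : IsTensor₃ (fun X Y Z p => c * t X Y Z p) where
  contMDiff X Y Z := contMDiff_const.mul (h.contMDiff X Y Z)
  left Y Z p := (h.left Y Z p).const_smul c
  mid X Z p := (h.mid X Z p).const_smul c
  right X Y p := (h.right X Y p).const_smul c

theorem neg (h : IsTensor₃ t) : IsTensor₃ (fun X Y Z p => -t X Y Z p) := by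
  simpa only [neg_one_mul] using h.const_mul (-1)

theorem sub (h : IsTensor₃ t) (h' : IsTensor₃ t') :
    IsTensor₃ (fun X Y Z p => t X Y Z p - t' X Y Z p) := by
  simpa only [sub_eq_add_neg] using h.add h'.neg

theorem rotate (h : IsTensor₃ t) : IsTensor₃ (fun X Y Z => t Y Z X) :=
  ⟨fun X Y Z => h.contMDiff Y Z X, fun Y Z => h.right Y Z, fun X Z => h.left Z X,
    fun X Y => h.mid Y X⟩

theorem swap (h : IsTensor₃ t) : IsTensor₃ (fun X Y Z => t Y X Z) :=
  ⟨fun X Y Z => h.contMDiff Y X Z, fun Y Z => h.mid Y Z, fun X Z => h.left X Z,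
    fun X Y => h.right Y X⟩

theorem J_left (h : IsTensor₃ t) (S : AlmostHermitianStructure E M) :
    IsTensor₃ (fun X Y Z => t (S.JField X) Y Z) :=
  ⟨fun _ Y Z => h.contMDiff _ Y Z, fun Y Z p => (h.left Y Z p).comp_JField S,
    fun _ Z => h.mid _ Z, fun _ Y => h.right _ Y⟩

theorem J_mid (h : IsTensor₃ t) (S : AlmostHermitianStructure E M) :
    IsTensor₃ (fun X Y Z => t X (S.JField Y) Z) := (h.swap.J_left S).swap

theorem J_right (h : IsTensor₃ t) (S : AlmostHermitianStructure E M) :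
    IsTensor₃ (fun X Y Z => t X Y (S.JField Z)) := (h.rotate.J_left S).rotate.rotate

end IsTensor₃

namespace SmoothConnection

variable {D : SmoothConnection E M} {S : AlmostHermitianStructure E M}

theorem IsMetric.isTensor₃_covDerivJ (h : D.IsMetric S) : IsTensor₃ (D.covDerivJ S) :=
  ⟨contMDiff_covDerivJ, isTensorialAt_covDerivJ_left, h.isTensorialAt_covDerivJ_mid,
    isTensorialAt_covDerivJ_right⟩

/-- Expressing the form through `F` leaves no derivative terms to cancel; the same device serves
`dω⁺`. -/
theorem IsMetric.isTensor₃_nijenhuis (h : D.IsMetric S) (hT : ∀ X Y p, D.torsion X Y p = 0) :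
    IsTensor₃ (fun X Y Z p => S.metric.inner p (S.nijenhuis X Y p) (Z p)) := by
  have hF := h.isTensor₃_covDerivJ
  simp only [inner_nijenhuis_eq hT]
  exact (((hF.J_right S).neg.add (hF.J_right S).swap).sub (hF.J_left S)).add (hF.J_left S).swap

theorem IsMetric.isTensor₃_dOmegaPlus (h : D.IsMetric S) (hT : ∀ X Y p, D.torsion X Y p = 0) :
    IsTensor₃ S.dOmegaPlus := by
  have hF := h.isTensor₃_covDerivJ
  have hd : IsTensor₃ S.dOmega := by
    have : S.dOmega = fun X Y Z p =>
        D.covDerivJ S X Y Z p + D.covDerivJ S Y Z X p + D.covDerivJ S Z X Y p := by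
      funext X Y Z p; exact h.dOmega_eq hT X Y Z p
    rw [this]
    exact (hF.add hF.rotate).add hF.rotate.rotate
  have : S.dOmegaPlus = fun X Y Z p => 3 / 4 * S.dOmega X Y Z p
      + 1 / 4 * (S.dOmega X (S.JField Y) (S.JField Z) p + S.dOmega (S.JField X) Y (S.JField Z) p
        + S.dOmega (S.JField X) (S.JField Y) Z p) := by
    funext X Y Z p; exact (h.hermitianRelations hT p).eta_mixed X Y Z
  rw [this]
  exact (hd.const_mul _).add (((((hd.J_mid S).J_right S).add ((hd.J_left S).J_right S)).add
    ((hd.J_left S).J_mid S)).const_mul _)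

end SmoothConnection

namespace AlmostHermitianStructure

variable {S : AlmostHermitianStructure E M}

namespace TangentForm11

variable (α : S.TangentForm11)

/-- The function `g (α (X, Y), Z)`. -/
def form (X Y Z : SmoothVectorField E M) (p : M) : ℝ :=
  S.metric.inner p (α.toFun p (X p) (Y p)) (Z p)

theorem isTensor₃_form : IsTensor₃ α.form where
  contMDiff X Y Z := contMDiff_metric S.metric
    ⟨fun p => α.toFun p (X p) (Y p), α.contMDiff_toFun.clm_bundle_apply₂ X.contMDiff Y.contMDiff⟩ Z
  left Y Z p := ⟨fun _ _ => by simp [form], fun _ _ => by simp [form]⟩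
  mid X Z p := ⟨fun _ _ => by simp [form], fun _ _ => by simp [form]⟩
  right X Y p := ⟨fun _ _ => by simp [form], fun _ _ => by simp [form]⟩

theorem toFun_swap (p : M) (u v : TangentSpace 𝓘(ℝ, E) p) : α.toFun p v u = -α.toFun p u v := by
  have := α.alternating p (u + v)
  simp only [map_add, add_apply, α.alternating, zero_add, add_zero] at this
  exact eq_neg_of_add_eq_zero_left (by simpa [add_comm] using this)

theorem toFun_J (p : M) (u v : TangentSpace 𝓘(ℝ, E) p) :
    α.toFun p (S.J p u) (S.J p v) = α.toFun p u v :=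
  (isType11_iff (S.J_J p) (fun c X Y => by simp) (fun c X Y => by simp)).1 (α.type11 p) u v

theorem relations11 (p : M) : Relations11 S.JField (fun X Y Z => α.form X Y Z p) where
  neg_mid X Y Z := (α.isTensor₃_form.mid X Z p).map_neg Y
  neg_right X Y Z := (α.isTensor₃_form.right X Y p).map_neg Z
  swap X Y Z := by simp [form, α.toFun_swap p (X p)]
  J_left X Y Z := by
    have := α.toFun_J p (S.J p (X p)) (Y p)
    rw [S.J_J, map_neg, neg_apply] at this
    simp [form, ← this]

/-- The right-hand side of the formula for the torsion. -/
def torsionForm (X Y Z : SmoothVectorField E M) (p : M) : ℝ :=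
  prescribedTorsion S.JField (fun X Y Z => S.dOmegaPlus X Y Z p)
    (fun X Y Z => S.metric.inner p (S.nijenhuis X Y p) (Z p)) (fun X Y Z => α.form X Y Z p) X Y Z

theorem _root_.SmoothConnection.hasTorsionOf_iff {D : SmoothConnection E M} :
    D.HasTorsionOf α ↔ ∀ (X Y Z : SmoothVectorField E M) (p : M),
      S.metric.inner p (D.torsion X Y p) (Z p) = α.torsionForm X Y Z p := Iff.rfl

theorem isTensor₃_torsionForm {D₀ : SmoothConnection E M} (h₀ : D₀.IsMetric S)
    (hT₀ : ∀ X Y p, D₀.torsion X Y p = 0) : IsTensor₃ α.torsionForm := by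
  have hN := h₀.isTensor₃_nijenhuis hT₀
  have hd := h₀.isTensor₃_dOmegaPlus hT₀
  have ha := α.isTensor₃_form
  have hc := (ha.add ha.rotate).add ha.rotate.rotate
  exact (((((hN.const_mul _).sub ((((hd.J_left S).J_mid S).J_right S).const_mul _)).add
    ((hd.J_right S).const_mul _)).add (hc.const_mul _)).sub
    (((hc.J_left S).J_mid S).const_mul _)).add ha

variable [FiniteDimensional ℝ E] [T2Space M]

theorem ext_form {α β : S.TangentForm11} (h : ∀ X Y Z p, α.form X Y Z p = β.form X Y Z p) :
    α = β := by
  refine TangentForm11.ext (funext fun p => ?_)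
  ext u v : 2
  refine metric_ext S.metric fun w => ?_
  simpa [form] using h (SmoothVectorField.extend p u) (SmoothVectorField.extend p v)
    (SmoothVectorField.extend p w) p

end TangentForm11

end AlmostHermitianStructure

variable [FiniteDimensional ℝ E] [T2Space M]

/-- A `C^∞`-bilinear map on vector fields is given by a smooth tensor field. -/
theorem exists_tensorField {B : SmoothVectorField E M → SmoothVectorField E M → SmoothVectorField E M}
    (hX : ∀ Y p, IsTensorialAt (fun X => B X Y p) p)
    (hY : ∀ X p, IsTensorialAt (fun Y => B X Y p) p) :
    ∃ β : (p : M) → TangentSpace 𝓘(ℝ, E) p →L[ℝ] TangentSpace 𝓘(ℝ, E) p →L[ℝ] TangentSpace 𝓘(ℝ, E) p,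
      ContMDiff 𝓘(ℝ, E) (𝓘(ℝ, E).prod 𝓘(ℝ, E →L[ℝ] E →L[ℝ] E)) ∞
        (fun p => TotalSpace.mk' (E →L[ℝ] E →L[ℝ] E)
          (E := fun p : M => TangentSpace 𝓘(ℝ, E) p →L[ℝ] TangentSpace 𝓘(ℝ, E) p →L[ℝ]
            TangentSpace 𝓘(ℝ, E) p) p (β p)) ∧
      ∀ (X Y : SmoothVectorField E M) (p : M), β p (X p) (Y p) = B X Y p := by
  have (p : M) : FiniteDimensional ℝ (TangentSpace 𝓘(ℝ, E) p) :=
    inferInstanceAs (FiniteDimensional ℝ E)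
  have (p : M) : T2Space (TangentSpace 𝓘(ℝ, E) p) := inferInstanceAs (T2Space E)
  -- Extensions of vectors are chosen non-linearly; tensoriality in `X` makes the result independent
  -- of the choice and hence linear in `u`.
  let b (p : M) : TangentSpace 𝓘(ℝ, E) p →ₗ[ℝ] TangentSpace 𝓘(ℝ, E) p →L[ℝ] TangentSpace 𝓘(ℝ, E) p :=
    { toFun := fun u => LinearMap.toContinuousLinearMap
        (hY (SmoothVectorField.extend p u) p).toLinearMap
      map_add' := fun u v => by
        ext w
        obtain ⟨W, rfl⟩ := SmoothVectorField.exists_eq p w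
        simp only [LinearMap.coe_toContinuousLinearMap', IsTensorialAt.toLinearMap_apply, add_apply]
        rw [← (hX W p).map_add]
        exact (hX W p).congr (by simp)
      map_smul' := fun c u => by
        ext w
        obtain ⟨W, rfl⟩ := SmoothVectorField.exists_eq p w
        simp only [LinearMap.coe_toContinuousLinearMap', IsTensorialAt.toLinearMap_apply, smul_apply,
          RingHom.id_apply]
        rw [← (hX W p).map_smul]
        exact (hX W p).congr (by simp) }
  have hb (X Y : SmoothVectorField E M) (p : M) :
      LinearMap.toContinuousLinearMap (b p) (X p) (Y p) = B X Y p := by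
    simp only [b, LinearMap.coe_toContinuousLinearMap', LinearMap.coe_mk, AddHom.coe_mk,
      IsTensorialAt.toLinearMap_apply]
    exact (hX Y p).congr (by simp)
  refine ⟨fun p => LinearMap.toContinuousLinearMap (b p), ?_, hb⟩
  refine contMDiff_hom_of_apply _ fun X => contMDiff_hom_of_apply _ fun Y => ?_
  simp only [hb]
  exact (B X Y).contMDiff

end Tensors

/-! ### The correspondence between Hermitian connections and (1,1)-forms -/

section Correspondence

variable {E : Type*} [NormedAddCommGroup E] [NormedSpace ℝ E]
  {M : Type*} [TopologicalSpace M] [ChartedSpace E M] [IsManifold 𝓘(ℝ, E) ∞ M]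

namespace SmoothConnection

variable {S : AlmostHermitianStructure E M}

variable [FiniteDimensional ℝ E]

theorem isTensorialAt_torsion_left (D : SmoothConnection E M) (Y : SmoothVectorField E M) (p : M) :
    IsTensorialAt (fun X => D.torsion X Y p) p where
  map_add X X' := by
    simp only [torsion, D.add_left, D.add_right, SmoothVectorField.add_apply,
      SmoothVectorField.bracket_add_left]
    abel
  map_fsmul f X := by
    simp only [torsion, D.fsmul_left, D.leibniz, SmoothVectorField.fsmul_apply,
      SmoothVectorField.bracket_fsmul_left, smul_sub]
    abel

theorem isTensorialAt_torsion_right (D : SmoothConnection E M) (X : SmoothVectorField E M) (p : M) :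
    IsTensorialAt (fun Y => D.torsion X Y p) p := by
  have h := D.isTensorialAt_torsion_left X p
  have hsw (Y : SmoothVectorField E M) := D.torsion_swap Y X p
  simp only [hsw]
  exact ⟨fun Y Y' => by rw [h.map_add, neg_add], fun f Y => by rw [h.map_fsmul, smul_neg]⟩

/-- The torsion as a vector field. -/
def torsionField (D : SmoothConnection E M) (X Y : SmoothVectorField E M) : SmoothVectorField E M :=
  D.toFun X Y - D.toFun Y X - ⟨X.bracket Y, X.contMDiff_bracket Y⟩

theorem torsionField_apply (D : SmoothConnection E M) (X Y : SmoothVectorField E M) (p : M) :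
    D.torsionField X Y p = D.torsion X Y p := rfl

variable [T2Space M]

/-- The `(1,1)`-part of the torsion. -/
theorem exists_torsion11 (D : SmoothConnection E M) (S : AlmostHermitianStructure E M) :
    ∃ α : S.TangentForm11, ∀ (X Y : SmoothVectorField E M) (p : M), α.toFun p (X p) (Y p) =
      (1 / 2 : ℝ) • (D.torsion X Y p + D.torsion (S.JField X) (S.JField Y) p) := by
  obtain ⟨β, hβs, hβ⟩ := exists_tensorField (E := E) (M := M) (B := fun X Y =>
      (1 / 2 : ℝ) • (D.torsionField X Y + D.torsionField (S.JField X) (S.JField Y)))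
    (fun Y p => ((D.isTensorialAt_torsion_left Y p).add
      ((D.isTensorialAt_torsion_left (S.JField Y) p).comp_JField S)).const_smul _)
    (fun X p => ((D.isTensorialAt_torsion_right X p).add
      ((D.isTensorialAt_torsion_right (S.JField X) p).comp_JField S)).const_smul _)
  simp only [SmoothVectorField.smul_apply, SmoothVectorField.add_apply, torsionField_apply] at hβ
  refine ⟨⟨β, hβs, fun p v => ?_, fun p => ?_⟩, hβ⟩
  · obtain ⟨X, rfl⟩ := SmoothVectorField.exists_eq p v
    have h0 (X : SmoothVectorField E M) : D.torsion X X p = 0 := by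
      simp [torsion, SmoothVectorField.bracket]
    simp [hβ, h0]
  · rw [isType11_iff (S.J_J p) (fun c X Y => by simp) (fun c X Y => by simp)]
    intro u v
    obtain ⟨X, rfl⟩ := SmoothVectorField.exists_eq p u
    obtain ⟨Y, rfl⟩ := SmoothVectorField.exists_eq p v
    -- Applying `J` to both arguments exchanges the two summands, since the two signs from `J² = -1`
    -- cancel.
    rw [← S.JField_apply, ← S.JField_apply, hβ, hβ, S.JField_JField, S.JField_JField,
      (D.isTensorialAt_torsion_left _ p).map_neg, (D.isTensorialAt_torsion_right _ p).map_neg,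
      neg_neg, add_comm]

theorem IsHermitian.exists_hasTorsionOf {D : SmoothConnection E M} (h : D.IsHermitian S) :
    ∃ α : S.TangentForm11, D.HasTorsionOf α := by
  obtain ⟨D₀, h₀, hT₀⟩ := S.exists_leviCivita
  obtain ⟨α, hα⟩ := D.exists_torsion11 S
  refine ⟨α, fun X Y Z p => ?_⟩
  refine (h₀.hermitianRelations hT₀ p).eq_prescribedTorsion
    (T := fun X Y Z => S.metric.inner p (D.torsion X Y p) (Z p))
    (a := fun X Y Z => α.form X Y Z p) (fun X Y Z => ?_) (fun X Y Z => ?_) (fun X Y Z => ?_)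
    (fun X Y Z => ?_) (fun X Y Z => ?_) X Y Z
  · simp [(D.isTensorialAt_torsion_left Y p).map_neg]
  · simp
  · simp [D.torsion_swap X Y]
  · have := h.1.two_mul_covDerivJ h₀ hT₀
      (t := fun X Y Z => S.metric.inner p (D.torsion X Y p) (Z p)) (fun X Y Z => rfl) X Y Z
    rw [(D.PreservesJ_iff S).1 h.2, mul_zero] at this
    exact this.symm
  · simp [AlmostHermitianStructure.TangentForm11.form, hα]
    ring

theorem IsMetric.isHermitian_of_hasTorsionOf {D : SmoothConnection E M} (h : D.IsMetric S)
    {α : S.TangentForm11} (hα : D.HasTorsionOf α) : D.IsHermitian S := by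
  obtain ⟨D₀, h₀, hT₀⟩ := S.exists_leviCivita
  refine ⟨h, (D.PreservesJ_iff S).2 fun X Y Z p => ?_⟩
  have h1 := h.two_mul_covDerivJ h₀ hT₀ (t := fun X Y Z => α.torsionForm X Y Z p)
    (fun X Y Z => hα X Y Z p) X Y Z
  have h2 := (h₀.hermitianRelations hT₀ p).preservesJ_of_prescribedTorsion (α.relations11 p) X Y Z
  simp only [AlmostHermitianStructure.TangentForm11.torsionForm] at h1
  linarith

theorem HasTorsionOf.form_unique {D : SmoothConnection E M} {α β : S.TangentForm11}
    (hα : D.HasTorsionOf α) (hβ : D.HasTorsionOf β) : α = β := by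
  obtain ⟨D₀, h₀, hT₀⟩ := S.exists_leviCivita
  refine AlmostHermitianStructure.TangentForm11.ext_form fun X Y Z p => ?_
  have key {γ : S.TangentForm11} (hγ : D.HasTorsionOf γ) :
      S.metric.inner p (D.torsion X Y p) (Z p)
        + S.metric.inner p (D.torsion (S.JField X) (S.JField Y) p) (Z p) = 2 * γ.form X Y Z p := by
    rw [(hasTorsionOf_iff γ).1 hγ, (hasTorsionOf_iff γ).1 hγ]
    exact (h₀.hermitianRelations hT₀ p).prescribedTorsion_add_J (γ.relations11 p) X Y Z
  linarith [key hα, key hβ]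

theorem IsMetric.eq_of_hasTorsionOf {D D' : SmoothConnection E M} (h : D.IsMetric S)
    (h' : D'.IsMetric S) {α : S.TangentForm11} (hα : D.HasTorsionOf α) (hα' : D'.HasTorsionOf α) :
    D = D' := by
  refine SmoothConnection.ext (funext fun X => funext fun Y => ContMDiffSection.ext fun p =>
    metric_ext S.metric fun u => ?_)
  obtain ⟨Z, rfl⟩ := SmoothVectorField.exists_eq p u
  have h1 := h.koszul_formula X Y Z p
  have h2 := h'.koszul_formula X Y Z p
  simp only [(hasTorsionOf_iff α).1 hα] at h1
  simp only [(hasTorsionOf_iff α).1 hα'] at h2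
  linarith

theorem exists_isHermitian_hasTorsionOf (α : S.TangentForm11) :
    ∃ D : SmoothConnection E M, D.IsHermitian S ∧ D.HasTorsionOf α := by
  obtain ⟨D₀, h₀, hT₀⟩ := S.exists_leviCivita
  have ht := α.isTensor₃_torsionForm h₀ hT₀
  have hsw (X Y Z p) : α.torsionForm Y X Z p = -α.torsionForm X Y Z p :=
    (h₀.hermitianRelations hT₀ p).prescribedTorsion_swap (α.relations11 p) X Y Z
  have hτ : IsTensor₃ (fun X Y Z p =>
      α.torsionForm X Y Z p - α.torsionForm X Z Y p - α.torsionForm Y Z X p) :=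
    (ht.sub ht.swap.rotate.rotate).sub ht.rotate
  obtain ⟨D, hD, h⟩ := S.exists_connection hτ.contMDiff hτ.left hτ.mid fun X Y Z p => by
    rw [hsw Y Z X]; ring
  -- Antisymmetrizing the contorsion in `X, Y` cancels its last two terms and doubles `torsionForm`,
  -- while the Koszul part contributes exactly the bracket.
  have hT : D.HasTorsionOf α := by
    rw [hasTorsionOf_iff α]
    intro X Y Z p
    have h1 := h X Y Z p
    have h2 := h Y X Z p
    have h3 := S.koszul_sub_koszul_swap X Y Z p
    have h4 := hsw X Y Z p
    simp only [torsion, map_sub, sub_apply]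
    linarith
  exact ⟨D, hD.isHermitian_of_hasTorsionOf hT, hT⟩

end SmoothConnection

end Correspondence
end

theorem mainTheorem3 {E : Type*} [NormedAddCommGroup E] [NormedSpace ℝ E] [FiniteDimensional ℝ E]
    {M : Type*} [TopologicalSpace M] [T2Space M] [ChartedSpace E M] [IsManifold 𝓘(ℝ, E) ∞ M]
    (S : AlmostHermitianStructure E M) :
    (∀ D : SmoothConnection E M, D.IsMetric S →
      (D.IsHermitian S ↔ ∃ α : S.TangentForm11, D.HasTorsionOf α)) ∧
    (∃ Φ : {D : SmoothConnection E M // D.IsHermitian S} ≃ S.TangentForm11,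
      ∀ (D : {D : SmoothConnection E M // D.IsHermitian S}) (α : S.TangentForm11),
        Φ D = α ↔ D.1.HasTorsionOf α) := by
  refine ⟨fun D hD => ⟨fun h => h.exists_hasTorsionOf, fun ⟨α, hα⟩ =>
    hD.isHermitian_of_hasTorsionOf hα⟩, ?_⟩
  -- The choice is harmless: `form_unique` shows that each connection admits only one form.
  choose Φ hΦ using fun D : {D : SmoothConnection E M // D.IsHermitian S} =>
    D.2.exists_hasTorsionOf
  refine ⟨Equiv.ofBijective Φ ⟨fun D D' h => Subtype.ext ?_, fun α => ?_⟩, fun D α => ⟨?_, ?_⟩⟩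
  · exact D.2.1.eq_of_hasTorsionOf D'.2.1 (hΦ D) (h ▸ hΦ D')
  · obtain ⟨D, hD, hα⟩ := SmoothConnection.exists_isHermitian_hasTorsionOf α
    exact ⟨⟨D, hD⟩, (hΦ ⟨D, hD⟩).form_unique hα⟩
  · rintro rfl
    exact hΦ D
  · exact (hΦ D).form_unique
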